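/- **Setting.** Let $k\ge 1$, $\alpha\ge 1$, $p$, $r$ be integers, $(\mathcal X,\mathcal A)$ a measurable space, $\mathcal Z\subset\mathbb R^p$ compact, and $(\mathbf X_i,\mathbf Z_i)_{i\ge 1}$ i.i.d. with values in $\mathcal X\times\mathbb R^p$, with a density $f_{\mathbf X,\mathbf Z}\ge 0$ with respect to $\mu\otimes\mathrm{Leb}_p$, where $\mu$ is $\sigma$-finite. Put $f_{\mathbf Z}(\mathbf z)=\int f_{\mathbf X,\mathbf Z}(\mathbf x,\mathbf z)\,d\mu(\mathbf x)$. For measurable $g:\mathcal X^k\to\mathbb R$ let $$\theta(\mathbf z_1,\dots,\mathbf z_k)=\mathbb E\big[g(\mathbf X_1,\dots,\mathbf X_k)\,\big|\,\mathbf Z_i=\mathbf z_i\ \forall i\big]=\int g(\mathbf x_1,\dots,\mathbf x_k)\prod_{i=1}^k\frac{f_{\mathbf X,\mathbf Z}(\mathbf x_i,\mathbf z_i)}{f_{\mathbf Z}(\mathbf z_i)}\,d\mu^{\otimes k}(\mathbf x).$$ For a kernel $K$ on $\mathbb R^p$, a bandwidth $h>0$ and $K_h=h^{-p}K(\cdot/h)$,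 let $$\hat\theta(\mathbf z_1,\dots,\mathbf z_k)=\frac{\sum_\sigma\prod_{i}K_h(\mathbf Z_{\sigma(i)}-\mathbf z_i)\,g(\mathbf X_{\sigma(1)},\dots,\mathbf X_{\sigma(k)})}{\sum_\sigma\prod_{i}K_h(\mathbf Z_{\sigma(i)}-\mathbf z_i)},$$ where $\sigma$ ranges over all injections $\{1,\dots,k\}\to\{1,\dots,n\}$; $\hat\theta$ is well defined when the denominator is positive. **Assumptions.** Multi-indices $m=(m_1,\dots,m_k)$ have non-negative integer entries unless said otherwise. 1. $K$ is measurable, bounded and integrable, $\int K=1$, and for $1\le j<\alpha$ all moments $\int K(\mathbf u)u_{i_1}\cdots u_{i_j}d\mathbf u$ exist and vanish. 2. $f_{\mathbf Z}$ is $\alpha$ times continuously differentiable on an open set that contains all points $\mathbf z+t\mathbf u$ with $\mathbf z\in\mathcal Z$, $K(\mathbf u)\ne 0$, $t\in[0,1]$, and there is a finite $C_{K,\alpha}$ such that for all $\mathbf z_1,\dots,\mathbf z_k\in\mathcal Z$ $$\int\Big|\prod_{i=1}^kK(\mathbf u_i)\Big|\sum_{m_1+\dots+m_k=\alpha}\binom{\alpha}{m_1,\dots,m_k}\prod_{i=1}^k\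 \sum_{j_1,\dots,j_{m_i}=1}^p|u_{i,j_1}\cdots u_{i,j_{m_i}}|\sup_{t\in[0,1]}\Big|\frac{\partial^{m_i}f_{\mathbf Z}}{\partial z_{j_1}\cdots\partial z_{j_{m_i}}}(\mathbf z_i+t\mathbf u_i)\Big|\,d\mathbf u_1\cdots d\mathbf u_k\le C_{K,\alpha}.$$ 3. $f_{\mathbf Z}\le f_{\max}<\infty$ everywhere, and $f_{\mathbf Z}>f_{\min}>0$ on $\mathcal Z$. 4. For every $\mathbf x$, the function $f_{\mathbf X,\mathbf Z}(\mathbf x,\cdot)$ is differentiable up to order $\alpha$ at almost every $\mathbf z$; for every $\mathbf z\in\mathcal Z$ it is so at $\mathbf z$ for $\mu$-almost every $\mathbf x$. There is a finite $C_{g,f,\alpha}$ such that for all integers $m_1,\dots,m_k\ge1$ with $\sum_i m_i=\alpha$, all indices $j_{i,1},\dots,j_{i,m_i}\in\{1,\dots,p\}$, and all $\mathbf z_i,\mathbf z_i+\mathbf u_i\in\mathcal Z$, $$\int\prod_{i=1}^k\Big|\big(g(\mathbf x_1,\dots,\mathbf x_k)-\theta(\mathbf z_1,\dots,\mathbf z_k)\big)\big(\partial_{j_{i,1}}\cdots\partial_{j_{i,m_i}}f_{\mathbf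 X,\mathbf Z}(\mathbf x_i,\mathbf z_i+\mathbf u_i)-\partial_{j_{i,1}}\cdots\partial_{j_{i,m_i}}f_{\mathbf X,\mathbf Z}(\mathbf x_i,\mathbf z_i)\big)\Big|\,d\mu^{\otimes k}(\mathbf x)\le C_{g,f,\alpha}\prod_{i=1}^k|\mathbf u_i|_\infty ,$$ the derivatives being taken in $\mathbf z$. The functions $\prod_iK(\mathbf u_i)\sum_{j_1,\dots,j_{m_i}}u_{i,j_1}\cdots u_{i,j_{m_i}}\prod_i|\mathbf u_i|_\infty$ with $\sum_i m_i=\alpha$ are integrable on $\mathbb R^{kp}$ (so that the sum of their integrals with weights $\binom{\alpha}{m_1,\dots,m_k}$ is at most a finite constant $C'_{K,\alpha}$). 5. (Conditional Bernstein) There are a positive function $B_g$ on $\mathbb R^{kp}$ and a finite $\tilde B_g$ with $\mathbb E[|g(\mathbf X_1,\dots,\mathbf X_k)|^l\,|\,\mathbf Z_i=\mathbf z_i\ \forall i]\le B_g(\mathbf z_1,\dots,\mathbf z_k)^l\,l!$ for all $l\ge 1$ and all $\mathbf z_i$ with $f_{\mathbf Z}(\mathbf z_i)>0$, and $B_g(\mathbf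 Z_1,\dots,\mathbf Z_k)\le\tilde B_g$ almost surely. 6. $\psi:\mathbb R^{kp}\to\mathbb R^r$ is bounded on $\mathcal Z^k$; $\Lambda$ is continuously differentiable with bounded derivative on an open neighbourhood of $\theta(\mathcal Z^k)$; and $\Lambda(\theta(\mathbf z_1,\dots,\mathbf z_k))=\psi(\mathbf z_1,\dots,\mathbf z_k)^T\beta^*$ for all $\mathbf z_1,\dots,\mathbf z_k\in\mathcal Z$, for some $\beta^*\in\mathbb R^r$. **Estimator.** For each $n'$ fix design points $\mathbf z'_1,\dots,\mathbf z'_{n'}\in\mathcal Z$ (possibly depending on $n'$) and a collection $\mathfrak I_{k,n'}$ (all, or only some) of injections $\{1,\dots,k\}\to\{1,\dots,n'\}$. For $h=h_{n,n'}>0$ and $\lambda_{n,n'}\ge0$ let $\hat\beta_{n,n'}$ be any minimizer over $\beta\in\mathbb R^r$ of $$\frac1{|\mathfrak I_{k,n'}|}\sum_{\sigma\in\mathfrak I_{k,n'}}\Big(\Lambda\big(\hat\theta(\mathbf z'_{\sigma(1)},\dots,\mathbf z'_{\sigma(k)})\big)-\psi(\mathbf z'_{\sigma(1)},\dots,\mathbf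 z'_{\sigma(k)})^T\beta\Big)^2+\lambda_{n,n'}|\beta|_1$$ on the event where all the $\hat\theta(\mathbf z'_{\sigma(1)},\dots,\mathbf z'_{\sigma(k)})$, $\sigma\in\mathfrak I_{k,n'}$, are well defined, and arbitrary elsewhere. **Theorem.** Suppose that $$\frac1{|\mathfrak I_{k,n'}|}\sum_{\sigma\in\mathfrak I_{k,n'}}\psi(\mathbf z'_{\sigma(1)},\dots,\mathbf z'_{\sigma(k)})\,\psi(\mathbf z'_{\sigma(1)},\dots,\mathbf z'_{\sigma(k)})^T\longrightarrow M\qquad(n'\to\infty),$$ and let $(n,n')\to\infty$ in a regime (along a sequence of pairs, or more generally along a proper filter on $\mathbb N^2$, with $n\to\infty$ and $n'\to\infty$) in which $h_{n,n'}\to0$, $\lambda_{n,n'}\to\lambda_0$, and $n'\exp(-A\,n\,h_{n,n'}^{2kp})\to0$ for every $A>0$. Let $$\mathbb G_{\infty,\infty}(\beta)=(\beta^*-\beta)M(\beta^*-\beta)^T+\lambda_0|\beta|_1 .$$ Then $\mathbb G_{\infty,\infty}$ has a minimizer, and along this regime $\hat\beta_{n,n'}\to\arg\min_\beta\mathbb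 G_{\infty,\infty}(\beta)$ in probability, in the following sense: if $\lambda_0>0$ or $M$ is invertible, then the distance of $\hat\beta_{n,n'}$ to the set of minimizers of $\mathbb G_{\infty,\infty}$ tends to $0$ in probability; and whenever $\mathbb G_{\infty,\infty}$ has a unique minimizer, $\hat\beta_{n,n'}$ converges to it in probability. Moreover, if $\lambda_0=0$ and $M$ is invertible, then $\hat\beta_{n,n'}\to\beta^*$ in probability. -/

import Mathlib

open MeasureTheory ProbabilityTheory Filter Topology

namespace CondUStat

/-- The set of global minimizers of `F`. -/
def argminSet {E : Type*} (F : E → ℝ) : Set E := {b | ∀ b', F b ≤ F b'}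

/-- The partial derivative `∂^m F / ∂z_{j 1} ⋯ ∂z_{j m}` at `z`. -/
noncomputable def partialD {p m : ℕ} (F : (Fin p → ℝ) → ℝ) (j : Fin m → Fin p)
    (z : Fin p → ℝ) : ℝ :=
  iteratedFDeriv ℝ m F z (fun l => Pi.single (j l) 1)

/-- `F` is differentiable at `z` up to the order `α`: its derivatives of order less than `α` are
differentiable at `z`, those of order less than `α - 1` even in a neighbourhood of `z`. -/
def DifferentiableUpTo {p : ℕ} (α : ℕ) (F : (Fin p → ℝ) → ℝ) (z : Fin p → ℝ) : Prop :=
  ∀ m < α, DifferentiableAt ℝ (iteratedFDeriv ℝ m F) z ∧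
    (m + 1 < α → ∀ᶠ w in 𝓝 z, DifferentiableAt ℝ (iteratedFDeriv ℝ m F) w)

section Model

variable {𝒳 : Type*} [MeasurableSpace 𝒳] {p k : ℕ}

/-- The marginal density `f_Z(z) = ∫ f_{X,Z}(x, z) dμ(x)`; `f x z` is the joint density. -/
noncomputable def fZ (μ : Measure 𝒳) (f : 𝒳 → (Fin p → ℝ) → ℝ) (z : Fin p → ℝ) : ℝ :=
  ∫ x, f x z ∂μ

/-- The density `∏ i, f_{X | Z = z i}(x i)` with respect to `μ^{⊗ k}` of the product of the
conditional laws `P_{X | Z = z 1}, …, P_{X | Z = z k}`. -/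
noncomputable def condDensity (μ : Measure 𝒳) (f : 𝒳 → (Fin p → ℝ) → ℝ)
    (z : Fin k → Fin p → ℝ) (x : Fin k → 𝒳) : ℝ :=
  ∏ i, (f (x i) (z i) / fZ μ f (z i))

/-- `θ(z 1, …, z k) = E[g(X 1, …, X k) | Z i = z i for all i]`. -/
noncomputable def theta (μ : Measure 𝒳) (f : 𝒳 → (Fin p → ℝ) → ℝ) (g : (Fin k → 𝒳) → ℝ)
    (z : Fin k → Fin p → ℝ) : ℝ :=
  ∫ x, g x * condDensity μ f z x ∂(Measure.pi fun _ : Fin k => μ)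

/-- `E[|g(X 1, …, X k)| ^ l | Z i = z i for all i]`, with values in `[0, ∞]`. -/
noncomputable def condAbsMoment (μ : Measure 𝒳) (f : 𝒳 → (Fin p → ℝ) → ℝ)
    (g : (Fin k → 𝒳) → ℝ) (l : ℕ) (z : Fin k → Fin p → ℝ) : ENNReal :=
  ∫⁻ x, ENNReal.ofReal (|g x| ^ l * condDensity μ f z x) ∂(Measure.pi fun _ : Fin k => μ)

/-- The rescaled kernel `K_h(u) = h^{-p} K(u / h)`. -/
noncomputable def scaledKernel (K : (Fin p → ℝ) → ℝ) (h : ℝ) (u : Fin p → ℝ) : ℝ :=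
  (h ^ p)⁻¹ * K (h⁻¹ • u)

/-- The denominator of `θ̂`: the sum over all injections `σ` from `{1, …, k}` to `{1, …, n}` of
`∏ i, K_h(Z_{σ i} - z i)`. The estimator is well defined when it is positive. -/
noncomputable def thetaHatDenom (K : (Fin p → ℝ) → ℝ) (h : ℝ) {n : ℕ}
    (Zs : Fin n → Fin p → ℝ) (z : Fin k → Fin p → ℝ) : ℝ :=
  ∑ σ : Fin k ↪ Fin n, ∏ i, scaledKernel K h (Zs (σ i) - z i)

/-- The kernel estimator `θ̂(z 1, …, z k)` built from the sample `(Xs i, Zs i)`, `i = 1, …, n`. -/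
noncomputable def thetaHat (K : (Fin p → ℝ) → ℝ) (h : ℝ) (g : (Fin k → 𝒳) → ℝ) {n : ℕ}
    (Xs : Fin n → 𝒳) (Zs : Fin n → Fin p → ℝ) (z : Fin k → Fin p → ℝ) : ℝ :=
  (∑ σ : Fin k ↪ Fin n, (∏ i, scaledKernel K h (Zs (σ i) - z i)) * g (fun i => Xs (σ i))) /
    thetaHatDenom K h Zs z

/-- The `l₁`-penalized least squares criterion
`|I|⁻¹ ∑_{σ ∈ I} (y σ - ψ(z'_{σ 1}, …, z'_{σ k})ᵀ β)² + lam |β|₁`,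
for a collection `I` of injections from `{1, …, k}` to `{1, …, n'}`. -/
noncomputable def lassoCriterion {r n' : ℕ} (ψ : (Fin k → Fin p → ℝ) → Fin r → ℝ)
    (z' : Fin n' → Fin p → ℝ) (I : Finset (Fin k ↪ Fin n')) (y : (Fin k ↪ Fin n') → ℝ)
    (lam : ℝ) (β : Fin r → ℝ) : ℝ :=
  (I.card : ℝ)⁻¹ * ∑ σ ∈ I, (y σ - ψ (fun i => z' (σ i)) ⬝ᵥ β) ^ 2 + lam * ∑ j, |β j|

/-- The empirical Gram matrix `|I|⁻¹ ∑_{σ ∈ I} ψ ψᵀ (z'_{σ 1}, …, z'_{σ k})`. -/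
noncomputable def gramMatrix {r n' : ℕ} (ψ : (Fin k → Fin p → ℝ) → Fin r → ℝ)
    (z' : Fin n' → Fin p → ℝ) (I : Finset (Fin k ↪ Fin n')) : Matrix (Fin r) (Fin r) ℝ :=
  (I.card : ℝ)⁻¹ • ∑ σ ∈ I,
    Matrix.vecMulVec (ψ (fun i => z' (σ i))) (ψ (fun i => z' (σ i)))

/-- The limit criterion `(β* - β) M (β* - β)ᵀ + lam |β|₁`. -/
noncomputable def limitCriterion {r : ℕ} (M : Matrix (Fin r) (Fin r) ℝ) (βstar : Fin r → ℝ)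
    (lam : ℝ) (β : Fin r → ℝ) : ℝ :=
  (βstar - β) ⬝ᵥ (M.mulVec (βstar - β)) + lam * ∑ j, |β j|

/-- `K` is a bounded kernel of order `α` with integral one. -/
def KernelAssumption (K : (Fin p → ℝ) → ℝ) (α : ℕ) : Prop :=
  Measurable K ∧ (∃ CK : ℝ, ∀ u, |K u| ≤ CK) ∧ Integrable K ∧ ∫ u, K u = 1 ∧
    ∀ j : ℕ, 1 ≤ j → j < α → ∀ i : Fin j → Fin p,
      Integrable (fun u : Fin p → ℝ => K u * ∏ l, u (i l)) ∧
      ∫ u : Fin p → ℝ, K u * ∏ l, u (i l) = 0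

/-- The density `q` is `α` times continuously differentiable wherever its derivatives are
evaluated, and the integrals of its derivatives against the kernel that bound the bias are
uniformly bounded. -/
def DensitySmoothness (k : ℕ) (K : (Fin p → ℝ) → ℝ) (α : ℕ) (𝒵 : Set (Fin p → ℝ))
    (q : (Fin p → ℝ) → ℝ) : Prop :=
  (∃ U : Set (Fin p → ℝ), IsOpen U ∧ ContDiffOn ℝ α q U ∧
    ∀ z ∈ 𝒵, ∀ u, K u ≠ 0 → ∀ t ∈ Set.Icc (0 : ℝ) 1, z + t • u ∈ U) ∧
  ∃ C : ℝ, ∀ z : Fin k → Fin p → ℝ, (∀ i, z i ∈ 𝒵) →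
    ∫⁻ u : Fin k → Fin p → ℝ, ENNReal.ofReal |∏ i, K (u i)| *
      ∑ m ∈ Finset.piAntidiag (Finset.univ : Finset (Fin k)) α,
        (Nat.multinomial Finset.univ m : ENNReal) *
          ∏ i, ∑ j : Fin (m i) → Fin p, ENNReal.ofReal |∏ l, u i (j l)| *
            ⨆ t ∈ Set.Icc (0 : ℝ) 1, ENNReal.ofReal |partialD q j (z i + t • u i)|
      ≤ ENNReal.ofReal C

/-- Regularity of the joint density in `z`: differentiability up to the order `α`, the Hölder-type
bound on the derivatives of order `α`, and finiteness of the corresponding kernel moments. -/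
def JointHolder (μ : Measure 𝒳) (f : 𝒳 → (Fin p → ℝ) → ℝ) (g : (Fin k → 𝒳) → ℝ)
    (K : (Fin p → ℝ) → ℝ) (α : ℕ) (𝒵 : Set (Fin p → ℝ)) : Prop :=
  (∀ x, ∀ᵐ z, DifferentiableUpTo α (f x) z) ∧
  (∀ z ∈ 𝒵, ∀ᵐ x ∂μ, DifferentiableUpTo α (f x) z) ∧
  (∃ C : ℝ, ∀ m : Fin k → ℕ, (∀ i, 1 ≤ m i) → ∑ i, m i = α →
    ∀ j : (i : Fin k) → Fin (m i) → Fin p, ∀ z u : Fin k → Fin p → ℝ,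
      (∀ i, z i ∈ 𝒵) → (∀ i, z i + u i ∈ 𝒵) →
      ∫⁻ x, ENNReal.ofReal (∏ i, |(g x - theta μ f g z) *
          (partialD (f (x i)) (j i) (z i + u i) - partialD (f (x i)) (j i) (z i))|)
        ∂(Measure.pi fun _ : Fin k => μ) ≤ ENNReal.ofReal (C * ∏ i, ‖u i‖)) ∧
  (∀ m ∈ Finset.piAntidiag (Finset.univ : Finset (Fin k)) α,
    Integrable (fun u : Fin k → Fin p → ℝ =>
      (∏ i, K (u i) * ∑ j : Fin (m i) → Fin p, ∏ l, u i (j l)) * ∏ i, ‖u i‖)) ∧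
  ∃ C' : ℝ, ∑ m ∈ Finset.piAntidiag (Finset.univ : Finset (Fin k)) α,
    (Nat.multinomial Finset.univ m : ℝ) * ∫ u : Fin k → Fin p → ℝ,
      (∏ i, K (u i) * ∑ j : Fin (m i) → Fin p, ∏ l, u i (j l)) * ∏ i, ‖u i‖ ≤ C'

/-- The conditional Bernstein assumption; `ν` is the law of `Z`. The conditional law given
`Z = z i` is only defined where the density of `Z` is positive. -/
def CondBernstein (μ : Measure 𝒳) (f : 𝒳 → (Fin p → ℝ) → ℝ) (g : (Fin k → 𝒳) → ℝ)
    (ν : Measure (Fin p → ℝ)) : Prop :=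
  ∃ B : (Fin k → Fin p → ℝ) → ℝ, (∀ z, 0 < B z) ∧
    (∀ l : ℕ, 1 ≤ l → ∀ z : Fin k → Fin p → ℝ, (∀ i, 0 < fZ μ f (z i)) →
      condAbsMoment μ f g l z ≤ ENNReal.ofReal (B z ^ l * (l.factorial : ℝ))) ∧
    ∃ Btilde : ℝ, ∀ᵐ z ∂(Measure.pi fun _ : Fin k => ν), B z ≤ Btilde

/-- `ψ` is bounded on `𝒵^k`, and the link function `Λ` is continuously differentiable with bounded
derivative on an open neighbourhood of the range of `θ` on `𝒵^k`. -/
def LinkAssumption {r : ℕ} (μ : Measure 𝒳) (f : 𝒳 → (Fin p → ℝ) → ℝ) (g : (Fin k → 𝒳) → ℝ)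
    (𝒵 : Set (Fin p → ℝ)) (ψ : (Fin k → Fin p → ℝ) → Fin r → ℝ) (Λ : ℝ → ℝ) : Prop :=
  (∃ Cψ : ℝ, ∀ z : Fin k → Fin p → ℝ, (∀ i, z i ∈ 𝒵) → ‖ψ z‖ ≤ Cψ) ∧
  ∃ V : Set ℝ, IsOpen V ∧ (∀ z : Fin k → Fin p → ℝ, (∀ i, z i ∈ 𝒵) → theta μ f g z ∈ V) ∧
    ContDiffOn ℝ 1 Λ V ∧ ∃ C : ℝ, ∀ t ∈ V, |deriv Λ t| ≤ C

end Model

end CondUStat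

/-! ### Concentration of U-statistics by averaging over disjoint blocks. -/

namespace CondUStat

/-! The estimator `θ̂` is a quotient of two U-statistics of order `k` (`embAvg` of `kernelTerm`):
one with kernel `∏ K_h(Z_i - z_i) g(X_1, …, X_k)`, and the same one with `g = 1`. Their means are
the convolutions of `numer`, that is of `θ ∏ f_Z` and of `∏ f_Z`, with a product kernel on `ℝ^{kp}`
at scale `h`. Everything is proved for a general `g` and used twice.

Noise. A U-statistic is the average, over permutations of the sample, of means of `⌊n/k⌋`
independent blocks. By convexity of `exp` its exponential moments are at most those of one such mean
(`lintegral_exp_embAvg_le`), and the Bernstein moments of `g` then give deviation probabilities at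
most `2 exp(-c ⌊n/k⌋ h^{2kp})` with `c` independent of the point `z`
(`exists_kernel_deviation_bound`). At most `n'^k` design tuples occur, so the rate condition makes
the union bound tend to zero (`tendsto_union_bound`).

Bias. Near a point of `𝒵^k` the densities `∏ f(x_i, y_i)` converge for almost every `x`, and so do
their total masses `∏ f_Z(y_i)`; Scheffé's lemma gives convergence in `L¹(μ^{⊗k})`. A bound on the
second moment of `g` upgrades this to continuity of `numer` (`continuousOn_numer`). The moment bound
is known only for almost every `y`, hence all statements are relative to the conull set
`goodPoints`, which suffices because convolutions ignore null sets. Compactness of `𝒵` makes the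
bias uniformly small (`exists_bandwidth_bias_le`).

Minimizers. With probability tending to one, all responses `Λ(θ̂)` are therefore close to `ψᵀβ*`, so
on each ball the lasso criterion is uniformly close to the limit criterion. Both are convex, and
minimizers of convex functions are stable under uniform approximation on a single large ball
(`exists_stability_argminSet`). No a priori bound on `β̂` is needed. -/

/-- The average of `φ` over all injections of `Fin k` into `Fin n`. -/
noncomputable def embAvg {k n : ℕ} (φ : (Fin k ↪ Fin n) → ℝ) : ℝ :=
  (Fintype.card (Fin k ↪ Fin n) : ℝ)⁻¹ * ∑ σ, φ σ

/-- Permutations act transitively on injections, so the sum over `π` is the same for every `e`;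
summing over `e` as well and exchanging the sums identifies it. -/
theorem sum_perm_embedding {k n : ℕ} (φ : (Fin k ↪ Fin n) → ℝ) (e : Fin k ↪ Fin n) :
    ∑ π : Equiv.Perm (Fin n), φ (e.trans π.toEmbedding) = (n.factorial : ℝ) * embAvg φ := by
  have key : ∀ σ : Fin k ↪ Fin n, ∑ π : Equiv.Perm (Fin n), φ (σ.trans π.toEmbedding) =
      ∑ π : Equiv.Perm (Fin n), φ (e.trans π.toEmbedding) := by
    intro σ
    obtain ⟨ρ, rfl⟩ := (Equiv.Perm.isMultiplyPretransitive (Fin n) k).exists_smul_eq e σ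
    exact Fintype.sum_equiv (Equiv.mulRight ρ) _ _ fun π => congrArg φ (by ext i; rfl)
  have h2 : ∑ σ : Fin k ↪ Fin n, ∑ π : Equiv.Perm (Fin n), φ (σ.trans π.toEmbedding) =
      n.factorial * ∑ σ, φ σ := by
    rw [Finset.sum_comm]
    have : ∀ π : Equiv.Perm (Fin n), ∑ σ : Fin k ↪ Fin n, φ (σ.trans π.toEmbedding) =
        ∑ σ, φ σ := fun π =>
      Fintype.sum_equiv (Equiv.embeddingCongr (Equiv.refl _) π) _ _
        fun σ => congrArg φ (by ext i; rfl)
    simp [this, Fintype.card_perm]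
  simp only [key, Finset.sum_const, Finset.card_univ, nsmul_eq_mul] at h2
  have hc : (Fintype.card (Fin k ↪ Fin n) : ℝ) ≠ 0 := by
    have : Nonempty (Fin k ↪ Fin n) := ⟨e⟩
    exact_mod_cast Fintype.card_ne_zero
  rw [embAvg, ← mul_assoc, mul_comm (n.factorial : ℝ), mul_assoc, ← h2, inv_mul_cancel_left₀ hc]

section Exponential

variable {Ω E : Type*} [MeasurableSpace Ω] [MeasurableSpace E] {P : Measure Ω}
  {W : ℕ → Ω → E} {ρ : Measure E}

theorem map_embedding_eq_pi [IsProbabilityMeasure P] {ι : Type*} [Fintype ι]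
    (hW : ∀ i, Measurable (W i))
    (hindep : iIndepFun W P) (hlaw : ∀ i, P.map (W i) = ρ) (τ : ι ↪ ℕ) :
    P.map (fun ω i => W (τ i) ω) = Measure.pi fun _ => ρ := by
  have := (hindep.precomp τ.injective).map_fun_eq_pi_map fun i => (hW (τ i)).aemeasurable
  simpa [hlaw] using this

/-- Currying turns the law of `m * k` independent variables into that of `m` independent blocks of
size `k`, and the integral factorizes over the blocks. -/
theorem lintegral_prod_blocks [IsProbabilityMeasure ρ] {m k : ℕ} (Φ : (Fin k → E) → ENNReal)
    (hΦ : Measurable Φ) :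
    ∫⁻ w : Fin m × Fin k → E, ∏ b, Φ (fun i => w (b, i)) ∂(Measure.pi fun _ => ρ) =
      (∫⁻ w, Φ w ∂(Measure.pi fun _ => ρ)) ^ m := by
  have hmap : (Measure.pi fun _ : Fin m × Fin k => ρ).map (MeasurableEquiv.curry _ _ E) =
      Measure.pi fun _ : Fin m => Measure.pi fun _ : Fin k => ρ := by
    have := Measure.infinitePi_map_curry (fun (_ : Fin m) (_ : Fin k) => ρ)
    simpa only [Measure.infinitePi_eq_pi] using this
  have hmeas : Measurable fun v : Fin m → Fin k → E => ∏ b, Φ (v b) := by fun_prop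
  calc _ = ∫⁻ v : Fin m → Fin k → E, ∏ b, Φ (v b) ∂(Measure.pi fun _ => Measure.pi fun _ => ρ) := by
        rw [← hmap, lintegral_map hmeas (MeasurableEquiv.measurable _)]; rfl
    _ = ∏ b : Fin m, ∫⁻ v : Fin m → Fin k → E, Φ (v b)
          ∂(Measure.pi fun _ => Measure.pi fun _ => ρ) :=
        lintegral_prod_eq_prod_lintegral_of_indepFun Finset.univ
          (fun (b : Fin m) (v : Fin m → Fin k → E) => Φ (v b))
          (iIndepFun_pi fun _ => hΦ.aemeasurable) fun b => by fun_prop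
    _ = _ := by
        have : ∀ b : Fin m, ∫⁻ v : Fin m → Fin k → E, Φ (v b)
          ∂(Measure.pi fun _ => Measure.pi fun _ => ρ) = ∫⁻ w, Φ w ∂(Measure.pi fun _ => ρ) :=
          fun b => (measurePreserving_eval (fun _ : Fin m => Measure.pi fun _ : Fin k => ρ)
            b).lintegral_comp hΦ
        simp [this]

/-- Hoeffding's bound of the exponential moments of a U-statistic by those of its kernel. -/
theorem lintegral_exp_embAvg_le [IsProbabilityMeasure P] (hW : ∀ i, Measurable (W i))
    (hindep : iIndepFun W P) (hlaw : ∀ i, P.map (W i) = ρ) {k m n : ℕ} (hmn : m * k ≤ n)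
    (φ : (Fin k → E) → ℝ) (hφ : Measurable φ) (s : ℝ) :
    ∫⁻ ω, ENNReal.ofReal (Real.exp
        (s * (m * embAvg fun σ : Fin k ↪ Fin n => φ fun i => W (σ i) ω))) ∂P ≤
      (∫⁻ w, ENNReal.ofReal (Real.exp (s * φ w)) ∂(Measure.pi fun _ => ρ)) ^ m := by
  have : IsProbabilityMeasure ρ := by
    rw [← hlaw 0]; exact Measure.isProbabilityMeasure_map (hW 0).aemeasurable
  -- Since `m * k ≤ n`, there is room for `m` disjoint blocks `e b` of `k` indices.
  obtain ⟨τ⟩ : Nonempty (Fin m × Fin k ↪ Fin n) :=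
    Function.Embedding.nonempty_of_card_le (by simpa using hmn)
  let e : Fin m → Fin k ↪ Fin n := fun b =>
    ⟨fun i => τ (b, i), fun i j hij => by simpa using hij⟩
  set D := ∫⁻ w, ENNReal.ofReal (Real.exp (s * φ w)) ∂(Measure.pi fun _ : Fin k => ρ) with hD
  have hfac : (0 : ℝ) < n.factorial := by positivity
  have hblock : ∀ π : Equiv.Perm (Fin n), ∫⁻ ω, ENNReal.ofReal (Real.exp
      (s * ∑ b, φ fun i => W (π (e b i)) ω)) ∂P = D ^ m := by
    intro π
    have hm : Measurable fun w : Fin k → E => ENNReal.ofReal (Real.exp (s * φ w)) := by fun_prop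
    rw [hD, ← lintegral_prod_blocks _ hm,
      ← map_embedding_eq_pi hW hindep hlaw ((τ.trans π.toEmbedding).trans Fin.valEmbedding),
      lintegral_map (by fun_prop) (by fun_prop)]
    refine lintegral_congr fun ω => ?_
    rw [← ENNReal.ofReal_prod_of_nonneg fun _ _ => (Real.exp_pos _).le, ← Real.exp_sum,
      Finset.mul_sum]
    rfl
  -- By `sum_perm_embedding`, `m * embAvg` is the average over `π` of the sums over the permuted
  -- blocks; Jensen's inequality for `exp` does the rest.
  have hpt : ∀ ω, ENNReal.ofReal (Real.exp
        (s * (m * embAvg fun σ : Fin k ↪ Fin n => φ fun i => W (σ i) ω))) ≤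
      ENNReal.ofReal (n.factorial : ℝ)⁻¹ * ∑ π : Equiv.Perm (Fin n), ENNReal.ofReal (Real.exp
        (s * ∑ b, φ fun i => W (π (e b i)) ω)) := by
    intro ω
    rw [← ENNReal.ofReal_sum_of_nonneg fun _ _ => (Real.exp_pos _).le,
      ← ENNReal.ofReal_mul (by positivity)]
    refine ENNReal.ofReal_le_ofReal ?_
    have hsum : s * (m * embAvg fun σ : Fin k ↪ Fin n => φ fun i => W (σ i) ω) =
        ∑ π : Equiv.Perm (Fin n), (n.factorial : ℝ)⁻¹ * (s * ∑ b, φ fun i => W (π (e b i)) ω) := by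
      rw [← Finset.mul_sum, ← Finset.mul_sum, Finset.sum_comm]
      have h1 := fun b => sum_perm_embedding
        (fun σ : Fin k ↪ Fin n => φ fun i => W (σ i) ω) (e b)
      have h2 : ∑ b, ∑ π : Equiv.Perm (Fin n), φ (fun i => W (π (e b i)) ω) =
          ∑ b : Fin m, (n.factorial : ℝ) * embAvg fun σ : Fin k ↪ Fin n => φ fun i => W (σ i) ω :=
        Finset.sum_congr rfl fun b _ => h1 b
      rw [h2]
      simp only [Finset.sum_const, Finset.card_univ, Fintype.card_fin, nsmul_eq_mul]
      field_simp
    rw [hsum, Finset.mul_sum]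
    have := convexOn_exp.map_sum_le (t := (Finset.univ : Finset (Equiv.Perm (Fin n))))
      (w := fun _ => (n.factorial : ℝ)⁻¹) (p := fun π => s * ∑ b, φ fun i => W (π (e b i)) ω)
      (fun _ _ => by positivity) (by simp [Fintype.card_perm, hfac.ne']) (fun _ _ => Set.mem_univ _)
    simpa only [smul_eq_mul] using this
  calc _ ≤ ∫⁻ ω, ENNReal.ofReal (n.factorial : ℝ)⁻¹ * ∑ π : Equiv.Perm (Fin n),
        ENNReal.ofReal (Real.exp (s * ∑ b, φ fun i => W (π (e b i)) ω)) ∂P := lintegral_mono hpt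
    _ = D ^ m := by
        rw [lintegral_const_mul _ (by fun_prop), lintegral_finsetSum _ (fun _ _ => by fun_prop)]
        simp only [hblock, Finset.sum_const, Finset.card_univ, Fintype.card_perm, Fintype.card_fin,
          nsmul_eq_mul]
        rw [← mul_assoc, ENNReal.ofReal_inv_of_pos hfac, ENNReal.ofReal_natCast,
          ENNReal.inv_mul_cancel (by simp [Nat.factorial_ne_zero]) (by simp), one_mul]

/-- For `x ≤ 0` the difference of the two sides is `2 (sinh |x| - |x|) ≥ 0`. -/
theorem exp_sub_one_sub_le (x : ℝ) : Real.exp x - 1 - x ≤ Real.exp |x| - 1 - |x| := by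
  rcases le_total 0 x with hx | hx
  · rw [abs_of_nonneg hx]
  · rw [abs_of_nonpos hx]
    have := Real.self_le_sinh_iff.2 (neg_nonneg.2 hx)
    rw [Real.sinh_eq, neg_neg] at this
    linarith

theorem hasSum_exp_remainder (x : ℝ) :
    HasSum (fun l : ℕ => x ^ (l + 2) / (l + 2).factorial) (Real.exp x - 1 - x) := by
  have h : HasSum (fun l : ℕ => x ^ l / l.factorial) (Real.exp x) := by
    rw [Real.exp_eq_exp_ℝ]
    exact NormedSpace.expSeries_div_hasSum_exp x
  have := (hasSum_nat_add_iff' 2).2 h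
  simpa [Finset.sum_range_succ, sub_sub] using this

/-- The exponential moments of a random variable whose absolute moments are at most
`b ^ l * l!`. -/
theorem lintegral_exp_le_of_moments {Q : Measure E} [IsProbabilityMeasure Q] {ξ : E → ℝ}
    (hξ : Measurable ξ) {b : ℝ} (hb0 : 0 ≤ b) (hb : b ≤ 1 / 2)
    (hmom : ∀ l : ℕ, ∫⁻ w, ENNReal.ofReal (|ξ w| ^ l) ∂Q ≤ ENNReal.ofReal (b ^ l * l.factorial)) :
    ∫⁻ w, ENNReal.ofReal (Real.exp (ξ w)) ∂Q ≤
      ENNReal.ofReal (Real.exp (∫ w, ξ w ∂Q + 2 * b ^ 2)) := by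
  have hint : Integrable ξ Q := by
    refine ⟨hξ.aestronglyMeasurable, ?_⟩
    rw [hasFiniteIntegral_iff_norm]
    refine lt_of_le_of_lt ?_ (lt_of_le_of_lt (hmom 1) ENNReal.ofReal_lt_top)
    simp
  -- The factorials cancel: the term of order `l + 2` of the series contributes at most `b ^ (l +
  -- 2)`, and the geometric sum `b² / (1 - b)` is at most `2 b²` since `b ≤ 1/2`.
  have hrem : ∫⁻ w, ENNReal.ofReal (Real.exp |ξ w| - 1 - |ξ w|) ∂Q ≤
      ENNReal.ofReal (2 * b ^ 2) := by
    have h1 : ∀ w, ENNReal.ofReal (Real.exp |ξ w| - 1 - |ξ w|) =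
        ∑' l : ℕ, ENNReal.ofReal (|ξ w| ^ (l + 2) / (l + 2).factorial) := fun w => by
      have := hasSum_exp_remainder |ξ w|
      rw [← this.tsum_eq, ENNReal.ofReal_tsum_of_nonneg (fun l => by positivity) this.summable]
    simp_rw [h1]
    rw [lintegral_tsum fun l => by fun_prop]
    have hgeo : HasSum (fun l : ℕ => b ^ 2 * b ^ l) (b ^ 2 * (1 - b)⁻¹) :=
      (hasSum_geometric_of_lt_one hb0 (by linarith)).mul_left _
    calc _ ≤ ∑' l : ℕ, ENNReal.ofReal (b ^ 2 * b ^ l) := by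
          refine ENNReal.tsum_le_tsum fun l => ?_
          have hf : (0 : ℝ) < (l + 2).factorial := by positivity
          simp_rw [div_eq_mul_inv, fun w => ENNReal.ofReal_mul (q := ((l + 2).factorial : ℝ)⁻¹)
            (pow_nonneg (abs_nonneg (ξ w)) (l + 2))]
          rw [lintegral_mul_const _ (by fun_prop)]
          refine (mul_le_mul_left (hmom (l + 2)) _).trans ?_
          rw [← ENNReal.ofReal_mul (by positivity)]
          refine ENNReal.ofReal_le_ofReal (le_of_eq ?_)
          field_simp
          ring
      _ = ENNReal.ofReal (b ^ 2 * (1 - b)⁻¹) := by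
          rw [← ENNReal.ofReal_tsum_of_nonneg (fun l => by positivity) hgeo.summable, hgeo.tsum_eq]
      _ ≤ _ := by
          refine ENNReal.ofReal_le_ofReal ?_
          rw [mul_comm]
          refine mul_le_mul_of_nonneg_right ?_ (by positivity)
          rw [inv_le_comm₀ (by linarith) (by norm_num)]
          linarith
  have hrnn : ∀ w, 0 ≤ Real.exp |ξ w| - 1 - |ξ w| := fun w => by
    linarith [Real.add_one_le_exp |ξ w|]
  have hrint : Integrable (fun w => Real.exp |ξ w| - 1 - |ξ w|) Q :=
    ⟨by fun_prop, (hasFiniteIntegral_iff_ofReal (ae_of_all _ hrnn)).2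
      (lt_of_le_of_lt hrem ENNReal.ofReal_lt_top)⟩
  have hrem' : ∫ w, (Real.exp |ξ w| - 1 - |ξ w|) ∂Q ≤ 2 * b ^ 2 := by
    rw [integral_eq_lintegral_of_nonneg_ae (ae_of_all _ hrnn) hrint.1]
    exact ENNReal.toReal_le_of_le_ofReal (by positivity) hrem
  have hexp : ∀ w, Real.exp (ξ w) ≤ 1 + ξ w + (Real.exp |ξ w| - 1 - |ξ w|) := fun w => by
    linarith [exp_sub_one_sub_le (ξ w)]
  have hsumint : Integrable (fun w => 1 + ξ w + (Real.exp |ξ w| - 1 - |ξ w|)) Q :=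
    ((integrable_const 1).add hint).add hrint
  calc _ ≤ ∫⁻ w, ENNReal.ofReal (1 + ξ w + (Real.exp |ξ w| - 1 - |ξ w|)) ∂Q :=
        lintegral_mono fun w => ENNReal.ofReal_le_ofReal (hexp w)
    _ = ENNReal.ofReal (∫ w, (1 + ξ w + (Real.exp |ξ w| - 1 - |ξ w|)) ∂Q) :=
        (ofReal_integral_eq_lintegral_ofReal hsumint
          (ae_of_all _ fun w => (Real.exp_pos _).le.trans (hexp w))).symm
    _ ≤ _ := by
        refine ENNReal.ofReal_le_ofReal ?_
        have h1 : ∫ w, (1 + ξ w) ∂Q = 1 + ∫ w, ξ w ∂Q := by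
          rw [integral_add (integrable_const 1) hint]; simp
        have h2 : ∫ w, (1 + ξ w + (Real.exp |ξ w| - 1 - |ξ w|)) ∂Q =
            ∫ w, (1 + ξ w) ∂Q + ∫ w, (Real.exp |ξ w| - 1 - |ξ w|) ∂Q :=
          integral_add ((integrable_const 1).add hint) hrint
        rw [h2, h1]
        linarith [Real.add_one_le_exp (∫ w, ξ w ∂Q + 2 * b ^ 2)]

/-- Chernoff's method for `m` times the U-statistic: each of the `m` blocks contributes a factor
`exp(s * mean + 2 (s b)²)`. -/
theorem measure_embAvg_upper_le [IsProbabilityMeasure P] (hW : ∀ i, Measurable (W i))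
    (hindep : iIndepFun W P) (hlaw : ∀ i, P.map (W i) = ρ) {k m n : ℕ} (hmn : m * k ≤ n)
    {φ : (Fin k → E) → ℝ} (hφ : Measurable φ) {b : ℝ} (hb0 : 0 ≤ b)
    (hmom : ∀ l : ℕ, ∫⁻ w, ENNReal.ofReal (|φ w| ^ l) ∂(Measure.pi fun _ => ρ) ≤
      ENNReal.ofReal (b ^ l * l.factorial)) {s : ℝ} (hs : 0 ≤ s) (hsb : s * b ≤ 1 / 2) (t : ℝ) :
    P {ω | t ≤ (embAvg fun σ : Fin k ↪ Fin n => φ fun i => W (σ i) ω) -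
      ∫ w, φ w ∂(Measure.pi fun _ => ρ)} ≤
      ENNReal.ofReal (Real.exp (m * (2 * (s * b) ^ 2 - s * t))) := by
  have : IsProbabilityMeasure ρ := by
    rw [← hlaw 0]; exact Measure.isProbabilityMeasure_map (hW 0).aemeasurable
  set e := ∫ w, φ w ∂(Measure.pi fun _ : Fin k => ρ) with he
  set U : Ω → ℝ := fun ω => embAvg fun σ : Fin k ↪ Fin n => φ fun i => W (σ i) ω with hU
  have h1 : ∫⁻ w, ENNReal.ofReal (Real.exp (s * φ w)) ∂(Measure.pi fun _ : Fin k => ρ) ≤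
      ENNReal.ofReal (Real.exp (s * e + 2 * (s * b) ^ 2)) := by
    have := lintegral_exp_le_of_moments (Q := Measure.pi fun _ : Fin k => ρ)
      (hφ.const_mul s) (by positivity) hsb fun l => ?_
    · rwa [integral_const_mul] at this
    · simp_rw [abs_mul, mul_pow, ENNReal.ofReal_mul (pow_nonneg (abs_nonneg s) l)]
      rw [lintegral_const_mul _ (by fun_prop), abs_of_nonneg hs, mul_assoc,
        ENNReal.ofReal_mul (by positivity)]
      exact mul_le_mul_right (hmom l) _
  have h2 := (lintegral_exp_embAvg_le hW hindep hlaw hmn φ hφ s).trans (pow_le_pow_left' h1 m)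
  rw [← ENNReal.ofReal_pow (Real.exp_pos _).le, ← Real.exp_nat_mul] at h2
  have hc : ENNReal.ofReal (Real.exp (s * (m * (t + e)))) ≠ 0 := by
    simp [Real.exp_pos]
  have h3 := (mul_meas_ge_le_lintegral₀ (μ := P)
    (f := fun ω => ENNReal.ofReal (Real.exp (s * (m * U ω))))
    (by simp only [hU, embAvg]; fun_prop) (ENNReal.ofReal (Real.exp (s * (m * (t + e)))))).trans h2
  have hsub : {ω | t ≤ U ω - e} ⊆ {ω | ENNReal.ofReal (Real.exp (s * (m * (t + e)))) ≤
      ENNReal.ofReal (Real.exp (s * (m * U ω)))} := by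
    intro ω hω
    have : t + e ≤ U ω := by linarith [Set.mem_ofPred_eq ▸ hω]
    refine ENNReal.ofReal_le_ofReal (Real.exp_le_exp.2 ?_)
    gcongr
  calc _ ≤ (ENNReal.ofReal (Real.exp (s * (m * (t + e)))))⁻¹ *
        ENNReal.ofReal (Real.exp (m * (s * e + 2 * (s * b) ^ 2))) := by
        rw [← ENNReal.mul_le_iff_le_inv hc ENNReal.ofReal_ne_top]
        exact (mul_le_mul_right (measure_mono hsub) _).trans h3
    _ = _ := by
        rw [← ENNReal.ofReal_inv_of_pos (Real.exp_pos _), ← Real.exp_neg,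
          ← ENNReal.ofReal_mul (Real.exp_pos _).le, ← Real.exp_add]
        congr 2
        ring

theorem embAvg_neg {k n : ℕ} (φ : (Fin k ↪ Fin n) → ℝ) :
    embAvg (fun σ => -φ σ) = -embAvg φ := by
  simp [embAvg]

/-- Concentration of a U-statistic whose kernel has absolute moments at most `b ^ l * l!`. -/
theorem measure_embAvg_deviation_le [IsProbabilityMeasure P] (hW : ∀ i, Measurable (W i))
    (hindep : iIndepFun W P) (hlaw : ∀ i, P.map (W i) = ρ) {k m n : ℕ} (hmn : m * k ≤ n)
    {φ : (Fin k → E) → ℝ} (hφ : Measurable φ) {b : ℝ} (hb0 : 0 ≤ b)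
    (hmom : ∀ l : ℕ, ∫⁻ w, ENNReal.ofReal (|φ w| ^ l) ∂(Measure.pi fun _ => ρ) ≤
      ENNReal.ofReal (b ^ l * l.factorial)) {s : ℝ} (hs : 0 ≤ s) (hsb : s * b ≤ 1 / 2) (t : ℝ) :
    P {ω | t ≤ |(embAvg fun σ : Fin k ↪ Fin n => φ fun i => W (σ i) ω) -
      ∫ w, φ w ∂(Measure.pi fun _ => ρ)|} ≤
      2 * ENNReal.ofReal (Real.exp (m * (2 * (s * b) ^ 2 - s * t))) := by
  have h1 := measure_embAvg_upper_le hW hindep hlaw hmn hφ hb0 hmom hs hsb t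
  have h2 := measure_embAvg_upper_le hW hindep hlaw hmn hφ.neg hb0
    (by simpa only [Pi.neg_apply, abs_neg] using hmom) hs hsb t
  rw [two_mul]
  refine (measure_mono fun ω hω => ?_).trans ((measure_union_le _ _).trans (add_le_add h1 h2))
  rcases le_abs.1 (show t ≤ |_| from hω) with h | h
  · exact Or.inl h
  · refine Or.inr ?_
    simp only [Set.mem_ofPred_eq, Pi.neg_apply, embAvg_neg, integral_neg]
    linarith

end Exponential

/-! ### Products of measures with densities. -/

theorem lintegral_pi_fin_prod {A : Type*} [MeasurableSpace A] {m : Measure A} [SigmaFinite m]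
    {n : ℕ} (φ : Fin n → A → ENNReal) (hφ : ∀ i, Measurable (φ i)) :
    ∫⁻ x, ∏ i, φ i (x i) ∂(Measure.pi fun _ : Fin n => m) = ∏ i, ∫⁻ a, φ i a ∂m := by
  induction n with
  | zero => simp
  | succ n ih =>
    have hmp := (measurePreserving_piFinSuccAbove (fun _ : Fin (n + 1) => m) 0).symm
    rw [← hmp.lintegral_comp (by fun_prop), lintegral_prod _ (by
      refine Measurable.aemeasurable ?_
      have := hmp.measurable
      fun_prop)]
    simp only [Fin.prod_univ_succ, MeasurableEquiv.piFinSuccAbove_symm_apply]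
    have h1 : ∀ (a : A), ∫⁻ x : Fin n → A, φ 0 a * ∏ i : Fin n, φ i.succ (x i)
        ∂(Measure.pi fun _ => m) = φ 0 a * ∏ i : Fin n, ∫⁻ a, φ i.succ a ∂m := fun a => by
      rw [lintegral_const_mul _ (by fun_prop), ih _ fun i => hφ _]
    rw [← lintegral_mul_const _ (hφ 0)]
    exact lintegral_congr fun a => h1 a

/-- It suffices to test on boxes, whose indicator times the product density is again a product of
functions of single coordinates. -/
theorem pi_withDensity {A : Type*} [MeasurableSpace A] {m : Measure A} [SigmaFinite m]
    {n : ℕ} {φ : A → ENNReal} (hφ : Measurable φ) [SigmaFinite (m.withDensity φ)] :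
    (Measure.pi fun _ : Fin n => m.withDensity φ) =
      (Measure.pi fun _ : Fin n => m).withDensity fun x => ∏ i, φ (x i) := by
  refine Measure.pi_eq fun s hs => ?_
  rw [withDensity_apply _ (MeasurableSet.univ_pi hs),
    ← lintegral_indicator (MeasurableSet.univ_pi hs)]
  have h1 : ∀ x : Fin n → A, (Set.univ.pi s).indicator (fun x => ∏ i, φ (x i)) x =
      ∏ i, (s i).indicator φ (x i) := by
    intro x
    by_cases hx : x ∈ Set.univ.pi s
    · rw [Set.indicator_of_mem hx]
      exact Finset.prod_congr rfl fun i _ => (Set.indicator_of_mem (hx i (Set.mem_univ i)) _).symm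
    · rw [Set.indicator_of_notMem hx]
      simp only [Set.mem_univ_pi, not_forall] at hx
      obtain ⟨i, hi⟩ := hx
      exact (Finset.prod_eq_zero (Finset.mem_univ i) (Set.indicator_of_notMem hi _)).symm
  simp_rw [h1]
  rw [lintegral_pi_fin_prod _ fun i => hφ.indicator (hs i)]
  exact Finset.prod_congr rfl fun i _ => by
    rw [lintegral_indicator (hs i), withDensity_apply _ (hs i)]

/-! ### The joint law of `k` observations and the moments of `g`. -/

section Density

set_option linter.unusedSectionVars false

variable {𝒳 : Type*} [MeasurableSpace 𝒳] {p k : ℕ} {μ : Measure 𝒳} [SigmaFinite μ]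
  {f : 𝒳 → (Fin p → ℝ) → ℝ}

/-- The joint density of `(X 1, …, X k)` and `(Z 1, …, Z k)`. -/
def prodDensity (f : 𝒳 → (Fin p → ℝ) → ℝ) (x : Fin k → 𝒳) (y : Fin k → Fin p → ℝ) : ℝ :=
  ∏ i, f (x i) (y i)

/-- The law with density `f` with respect to `μ ⊗ Leb`. -/
noncomputable def pairLaw (μ : Measure 𝒳) (f : 𝒳 → (Fin p → ℝ) → ℝ) :
    Measure (𝒳 × (Fin p → ℝ)) :=
  (μ.prod volume).withDensity fun q => ENNReal.ofReal (f q.1 q.2)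

/-- The marginal density in the second variable, with values in `[0, ∞]`. -/
noncomputable def margDensity (μ : Measure 𝒳) (f : 𝒳 → (Fin p → ℝ) → ℝ) (y : Fin p → ℝ) :
    ENNReal :=
  ∫⁻ x, ENNReal.ofReal (f x y) ∂μ

theorem measurable_prodDensity (hf : Measurable (Function.uncurry f)) :
    Measurable fun q : (Fin k → 𝒳) × (Fin k → Fin p → ℝ) => prodDensity f q.1 q.2 :=
  Finset.measurable_prod _ fun i _ => hf.comp (by fun_prop :
    Measurable fun q : (Fin k → 𝒳) × (Fin k → Fin p → ℝ) => (q.1 i, q.2 i))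

theorem measurable_prodDensity_left (hf : Measurable (Function.uncurry f))
    (y : Fin k → Fin p → ℝ) : Measurable fun x => prodDensity f x y :=
  (measurable_prodDensity hf).comp (by fun_prop : Measurable fun x => (x, y))

theorem measurable_ofReal_density (hf : Measurable (Function.uncurry f)) :
    Measurable fun q : 𝒳 × (Fin p → ℝ) => ENNReal.ofReal (f q.1 q.2) :=
  ENNReal.measurable_ofReal.comp hf

theorem measurable_ofReal_prodDensity (hf : Measurable (Function.uncurry f)) :
    Measurable fun q : (Fin k → 𝒳) × (Fin k → Fin p → ℝ) =>
      ENNReal.ofReal (prodDensity f q.1 q.2) :=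
  ENNReal.measurable_ofReal.comp (measurable_prodDensity hf)

theorem measurable_ofReal_prodDensity_left (hf : Measurable (Function.uncurry f))
    (y : Fin k → Fin p → ℝ) : Measurable fun x => ENNReal.ofReal (prodDensity f x y) :=
  ENNReal.measurable_ofReal.comp (measurable_prodDensity_left hf y)

theorem prodDensity_nonneg (hf0 : ∀ x z, 0 ≤ f x z) (x : Fin k → 𝒳) (y : Fin k → Fin p → ℝ) :
    0 ≤ prodDensity f x y :=
  Finset.prod_nonneg fun _ _ => hf0 _ _

theorem measurable_margDensity (hf : Measurable (Function.uncurry f)) :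
    Measurable (margDensity μ f) :=
  (measurable_ofReal_density hf).lintegral_prod_left'

theorem lintegral_pairLaw (hf : Measurable (Function.uncurry f)) :
    ∫⁻ y, margDensity μ f y = pairLaw μ f Set.univ := by
  rw [pairLaw, withDensity_apply _ MeasurableSet.univ, setLIntegral_univ, lintegral_prod_symm _
    (measurable_ofReal_density hf).aemeasurable]
  rfl

theorem lintegral_prodDensity (hf : Measurable (Function.uncurry f)) (hf0 : ∀ x z, 0 ≤ f x z)
    (y : Fin k → Fin p → ℝ) :
    ∫⁻ x, ENNReal.ofReal (prodDensity f x y) ∂(Measure.pi fun _ => μ) =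
      ∏ i, margDensity μ f (y i) := by
  simp_rw [prodDensity, ENNReal.ofReal_prod_of_nonneg fun i (_ : i ∈ Finset.univ) => hf0 _ _]
  exact lintegral_pi_fin_prod (fun i a => ENNReal.ofReal (f a (y i))) fun i =>
    ENNReal.measurable_ofReal.comp (hf.comp (by fun_prop : Measurable fun x => (x, y i)))

theorem margDensity_eq_of_ne_top (hf : Measurable (Function.uncurry f)) (hf0 : ∀ x z, 0 ≤ f x z)
    {y : Fin p → ℝ} (hy : margDensity μ f y ≠ ⊤) :
    margDensity μ f y = ENNReal.ofReal (fZ μ f y) := by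
  rw [fZ, integral_eq_lintegral_of_nonneg_ae (ae_of_all _ fun x => hf0 x y)
    (hf.comp (by fun_prop : Measurable fun x => (x, y))).aestronglyMeasurable]
  exact (ENNReal.ofReal_toReal hy).symm

/-- The Bochner integral of a non-integrable function is `0`, so a positive value of `fZ` certifies
integrability. -/
theorem integrable_of_fZ_pos {y : Fin p → ℝ} (hy : 0 < fZ μ f y) :
    Integrable (fun x => f x y) μ := by
  by_contra h
  rw [fZ, integral_undef h] at hy
  exact hy.false

theorem margDensity_eq_of_fZ_pos (hf0 : ∀ x z, 0 ≤ f x z) {y : Fin p → ℝ} (hy : 0 < fZ μ f y) :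
    margDensity μ f y = ENNReal.ofReal (fZ μ f y) :=
  (ofReal_integral_eq_lintegral_ofReal (integrable_of_fZ_pos hy)
    (ae_of_all _ fun x => hf0 x y)).symm

theorem ae_margDensity_ne_top (hf : Measurable (Function.uncurry f))
    [IsProbabilityMeasure (pairLaw μ f)] : ∀ᵐ y, margDensity μ f y ≠ ⊤ := by
  refine (ae_lt_top (measurable_margDensity hf) ?_).mono fun y hy => hy.ne
  rw [lintegral_pairLaw hf, measure_univ]
  exact ENNReal.one_ne_top

theorem ae_all_margDensity_ne_top (hf : Measurable (Function.uncurry f))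
    [IsProbabilityMeasure (pairLaw μ f)] :
    ∀ᵐ y : Fin k → Fin p → ℝ, ∀ i, margDensity μ f (y i) ≠ ⊤ :=
  eventually_all.2 fun i => (Measure.quasiMeasurePreserving_eval
    (fun _ : Fin k => (volume : Measure (Fin p → ℝ))) i).ae (ae_margDensity_ne_top hf)

/-- Regrouping `k` pairs into a pair of `k`-tuples carries the product of the dominating measures to
the product of theirs, and the density along with it. -/
theorem pi_pairLaw_map (hf : Measurable (Function.uncurry f)) (hf0 : ∀ x z, 0 ≤ f x z)
    [IsProbabilityMeasure (pairLaw μ f)] :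
    (Measure.pi fun _ : Fin k => pairLaw μ f).map
      (MeasurableEquiv.arrowProdEquivProdArrow 𝒳 (Fin p → ℝ) (Fin k)) =
      ((Measure.pi fun _ => μ).prod volume).withDensity
        fun q => ENNReal.ofReal (prodDensity f q.1 q.2) := by
  have hφ := measurable_ofReal_density hf
  have : IsProbabilityMeasure ((μ.prod volume).withDensity
    fun q : 𝒳 × (Fin p → ℝ) => ENNReal.ofReal (f q.1 q.2)) := ‹IsProbabilityMeasure (pairLaw μ f)›
  have hmp := measurePreserving_arrowProdEquivProdArrow 𝒳 (Fin p → ℝ) (Fin k) (fun _ => μ)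
    (fun _ => volume)
  have hF := measurable_ofReal_prodDensity (k := k) hf
  have hpi : (Measure.pi fun _ : Fin k => pairLaw μ f) = _ := pi_withDensity hφ
  rw [hpi]
  ext s hs
  rw [Measure.map_apply (MeasurableEquiv.measurable _) hs,
    withDensity_apply _ (MeasurableEquiv.measurable _ hs), withDensity_apply _ hs]
  refine Eq.trans (lintegral_congr fun w => ?_) (hmp.setLIntegral_comp_preimage hs hF)
  rw [prodDensity, ENNReal.ofReal_prod_of_nonneg fun _ _ => hf0 _ _]
  rfl

theorem lintegral_pi_pairLaw (hf : Measurable (Function.uncurry f)) (hf0 : ∀ x z, 0 ≤ f x z)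
    [IsProbabilityMeasure (pairLaw μ f)]
    {Φ : (Fin k → 𝒳) × (Fin k → Fin p → ℝ) → ENNReal} (hΦ : Measurable Φ) :
    ∫⁻ w, Φ (fun i => (w i).1, fun i => (w i).2) ∂(Measure.pi fun _ : Fin k => pairLaw μ f) =
      ∫⁻ y, ∫⁻ x, Φ (x, y) * ENNReal.ofReal (prodDensity f x y) ∂(Measure.pi fun _ => μ) := by
  have hF := measurable_ofReal_prodDensity (k := k) hf
  calc _ = ∫⁻ q, Φ q ∂((Measure.pi fun _ : Fin k => pairLaw μ f).map
      (MeasurableEquiv.arrowProdEquivProdArrow 𝒳 (Fin p → ℝ) (Fin k))) :=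
        (lintegral_map hΦ (MeasurableEquiv.measurable _)).symm
    _ = _ := by
        rw [pi_pairLaw_map hf hf0, lintegral_withDensity_eq_lintegral_mul _ hF hΦ,
          lintegral_prod_symm _ (hF.mul hΦ).aemeasurable]
        simp only [Pi.mul_apply, mul_comm]

theorem integral_pi_pairLaw (hf : Measurable (Function.uncurry f)) (hf0 : ∀ x z, 0 ≤ f x z)
    [IsProbabilityMeasure (pairLaw μ f)]
    {Φ : (Fin k → 𝒳) × (Fin k → Fin p → ℝ) → ℝ}
    (hint : Integrable (fun w : Fin k → 𝒳 × (Fin p → ℝ) =>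
      Φ (fun i => (w i).1, fun i => (w i).2)) (Measure.pi fun _ : Fin k => pairLaw μ f)) :
    Integrable (fun q : (Fin k → 𝒳) × (Fin k → Fin p → ℝ) => Φ q * prodDensity f q.1 q.2)
      ((Measure.pi fun _ => μ).prod volume) ∧
    ∫ w, Φ (fun i => (w i).1, fun i => (w i).2) ∂(Measure.pi fun _ : Fin k => pairLaw μ f) =
      ∫ y, ∫ x, Φ (x, y) * prodDensity f x y ∂(Measure.pi fun _ => μ) := by
  have hF := measurable_ofReal_prodDensity (k := k) hf
  have hmap := pi_pairLaw_map (k := k) hf hf0 (μ := μ)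
  set e := MeasurableEquiv.arrowProdEquivProdArrow 𝒳 (Fin p → ℝ) (Fin k)
  have h1 : Integrable Φ (((Measure.pi fun _ => μ).prod volume).withDensity
        fun q => ENNReal.ofReal (prodDensity f q.1 q.2)) := by
    rw [← hmap, integrable_map_equiv]
    exact hint
  have hlt : ∀ᵐ q : (Fin k → 𝒳) × (Fin k → Fin p → ℝ) ∂((Measure.pi fun _ => μ).prod volume),
      ENNReal.ofReal (prodDensity f q.1 q.2) < ⊤ := ae_of_all _ fun _ => ENNReal.ofReal_lt_top
  have h2 : Integrable (fun q : (Fin k → 𝒳) × (Fin k → Fin p → ℝ) => Φ q * prodDensity f q.1 q.2)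
      ((Measure.pi fun _ => μ).prod volume) := by
    rw [integrable_withDensity_iff hF hlt] at h1
    simpa only [ENNReal.toReal_ofReal (prodDensity_nonneg hf0 _ _)] using h1
  refine ⟨h2, ?_⟩
  calc _ = ∫ q, Φ q ∂((Measure.pi fun _ : Fin k => pairLaw μ f).map e) :=
        (integral_map_equiv e Φ).symm
    _ = _ := by
        rw [hmap, integral_withDensity_eq_integral_toReal_smul hF hlt, ← integral_prod_symm _ h2]
        simp only [ENNReal.toReal_ofReal (prodDensity_nonneg hf0 _ _), smul_eq_mul, mul_comm]

/-- The conditional absolute moments of `g`, weighted by the density of the conditioning variables,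
are at most `B ^ l * l!` times that density almost everywhere. -/
def MomentBound (μ : Measure 𝒳) (f : 𝒳 → (Fin p → ℝ) → ℝ) (g : (Fin k → 𝒳) → ℝ) (B : ℝ) : Prop :=
  ∀ᵐ y : Fin k → Fin p → ℝ, ∀ l : ℕ,
    ∫⁻ x, ENNReal.ofReal (|g x| ^ l) * ENNReal.ofReal (prodDensity f x y)
      ∂(Measure.pi fun _ => μ) ≤
      ENNReal.ofReal (B ^ l * l.factorial) * ∏ i, margDensity μ f (y i)

/-- The denominator of `θ̂` is the numerator for `g = 1`; this makes the general results apply to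
it. -/
theorem momentBound_one (hf : Measurable (Function.uncurry f)) (hf0 : ∀ x z, 0 ≤ f x z) :
    MomentBound (k := k) μ f (fun _ => 1) 1 := by
  refine ae_of_all _ fun y l => ?_
  simp only [abs_one, one_pow, ENNReal.ofReal_one, one_mul, lintegral_prodDensity hf hf0]
  exact le_mul_of_one_le_left' (by simpa using Nat.one_le_iff_ne_zero.2 l.factorial_ne_zero)

theorem map_snd_eq_withDensity (hf : Measurable (Function.uncurry f)) :
    (pairLaw μ f).map Prod.snd = volume.withDensity (margDensity μ f) := by
  ext s hs
  rw [Measure.map_apply measurable_snd hs, withDensity_apply _ hs, pairLaw,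
    withDensity_apply _ (measurable_snd hs), ← lintegral_indicator (measurable_snd hs),
    lintegral_prod_symm _ ((measurable_ofReal_density hf).indicator
      (measurable_snd hs)).aemeasurable, ← lintegral_indicator hs]
  refine lintegral_congr fun y => ?_
  by_cases hy : y ∈ s
  · simp [hy, Set.indicator, margDensity]
  · simp [hy, Set.indicator]

/-- Multiplying by `∏ f_Z(y_i)` removes the division in the conditional density, so that the bound
also makes sense, and is trivial, where that product vanishes. -/
theorem CondBernstein.exists_momentBound (hf : Measurable (Function.uncurry f))
    (hf0 : ∀ x z, 0 ≤ f x z) [IsProbabilityMeasure (pairLaw μ f)] {g : (Fin k → 𝒳) → ℝ}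
    {ν : Measure (Fin p → ℝ)} (hν : ν = (pairLaw μ f).map Prod.snd)
    (h : CondBernstein μ f g ν) :
    ∃ B, 0 ≤ B ∧ MomentBound μ f g B := by
  obtain ⟨B, hB0, hB, Bt, hBt⟩ := h
  refine ⟨|Bt|, abs_nonneg _, ?_⟩
  rw [map_snd_eq_withDensity hf] at hν
  have hprob : IsProbabilityMeasure (volume.withDensity (margDensity μ f)) := by
    rw [← map_snd_eq_withDensity hf]
    exact Measure.isProbabilityMeasure_map measurable_snd.aemeasurable
  have hmeas := measurable_margDensity (μ := μ) hf
  -- Almost surely for the law of the `Z_i` means: for Lebesgue-almost every `y` at which the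
  -- product density is nonzero.
  rw [hν, pi_withDensity hmeas, ae_withDensity_iff (by fun_prop)] at hBt
  filter_upwards [ae_all_margDensity_ne_top (μ := μ) (k := k) hf, hBt] with y hy hBy l
  -- The Bernstein condition starts at `l = 1`; for `l = 0` both sides are the total mass.
  rcases Nat.eq_zero_or_pos l with rfl | hl
  · simp [lintegral_prodDensity hf hf0]
  by_cases hpos : ∏ i, margDensity μ f (y i) = 0
  · rw [hpos, mul_zero]
    rw [← lintegral_prodDensity hf hf0, lintegral_eq_zero_iff
      (measurable_ofReal_prodDensity_left hf y)] at hpos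
    refine le_of_eq ?_
    refine (lintegral_congr_ae ?_).trans lintegral_zero
    filter_upwards [hpos] with x hx
    rw [show ENNReal.ofReal (prodDensity f x y) = 0 from hx, mul_zero]
  have hposi : ∀ i, 0 < fZ μ f (y i) := fun i => by
    have := Finset.prod_ne_zero_iff.1 hpos i (Finset.mem_univ i)
    rw [margDensity_eq_of_ne_top hf hf0 (hy i)] at this
    exact ENNReal.ofReal_pos.1 (pos_iff_ne_zero.2 this)
  have hD : 0 < ∏ i, fZ μ f (y i) := Finset.prod_pos fun i _ => hposi i
  have hDeq : ∏ i, margDensity μ f (y i) = ENNReal.ofReal (∏ i, fZ μ f (y i)) := by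
    rw [ENNReal.ofReal_prod_of_nonneg fun i _ => (hposi i).le]
    exact Finset.prod_congr rfl fun i _ => margDensity_eq_of_fZ_pos hf0 (hposi i)
  have hBle : B y ^ l ≤ |Bt| ^ l :=
    pow_le_pow_left₀ (hB0 y).le ((hBy hpos).trans (le_abs_self _)) l
  calc _ = ∫⁻ x, ENNReal.ofReal (|g x| ^ l * condDensity μ f y x) *
        ∏ i, margDensity μ f (y i) ∂(Measure.pi fun _ => μ) := by
        refine lintegral_congr fun x => ?_
        have hc : 0 ≤ condDensity μ f y x :=
          Finset.prod_nonneg fun i _ => div_nonneg (hf0 _ _) (hposi i).le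
        rw [hDeq, ← ENNReal.ofReal_mul (by positivity),
          ← ENNReal.ofReal_mul (mul_nonneg (by positivity) hc), condDensity,
          Finset.prod_div_distrib, mul_assoc, div_mul_cancel₀ _ hD.ne']
        rfl
    _ = condAbsMoment μ f g l y * ∏ i, margDensity μ f (y i) := by
        rw [lintegral_mul_const' _ _ (by rw [hDeq]; exact ENNReal.ofReal_ne_top)]
        rfl
    _ ≤ _ := by
        refine mul_le_mul_left ((hB l hl y hposi).trans (ENNReal.ofReal_le_ofReal ?_)) _
        gcongr

theorem MomentBound.lintegral_le (hf : Measurable (Function.uncurry f))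
    (hf0 : ∀ x z, 0 ≤ f x z) [IsProbabilityMeasure (pairLaw μ f)] {g : (Fin k → 𝒳) → ℝ}
    (hg : Measurable g) {B : ℝ} (h : MomentBound μ f g B) (l : ℕ) :
    ∫⁻ w, ENNReal.ofReal (|g fun i => (w i).1| ^ l) ∂(Measure.pi fun _ : Fin k => pairLaw μ f) ≤
      ENNReal.ofReal (B ^ l * l.factorial) := by
  have hmeas := measurable_margDensity (μ := μ) hf
  calc _ = ∫⁻ y, ∫⁻ x, ENNReal.ofReal (|g x| ^ l) * ENNReal.ofReal (prodDensity f x y)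
        ∂(Measure.pi fun _ => μ) :=
        lintegral_pi_pairLaw hf hf0 (Φ := fun q => ENNReal.ofReal (|g q.1| ^ l)) (by fun_prop)
    _ ≤ ∫⁻ y : Fin k → Fin p → ℝ, ENNReal.ofReal (B ^ l * l.factorial) *
          ∏ i, margDensity μ f (y i) := lintegral_mono_ae (h.mono fun y hy => hy l)
    _ = _ := by
        rw [lintegral_const_mul _ (by fun_prop), volume_pi,
          lintegral_pi_fin_prod (fun _ => margDensity μ f) fun _ => hmeas]
        simp [lintegral_pairLaw hf]

end Density

/-! ### Convergence in L¹ of densities and of integrals against an unbounded `g`. -/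

section L1

variable {A ι : Type*} [MeasurableSpace A] {m : Measure A} {l : Filter ι}
  {F : ι → A → ℝ} {F₀ : A → ℝ}

/-- Scheffé's lemma. -/
theorem tendsto_integral_abs_sub_of_tendsto_integral [l.IsCountablyGenerated]
    (hF : ∀ᶠ i in l, Integrable (F i) m) (hF₀ : Integrable F₀ m) (hpos : ∀ i a, 0 ≤ F i a)
    (hlim : ∀ᵐ a ∂m, Tendsto (fun i => F i a) l (𝓝 (F₀ a)))
    (hint : Tendsto (fun i => ∫ a, F i a ∂m) l (𝓝 (∫ a, F₀ a ∂m))) :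
    Tendsto (fun i => ∫ a, |F i a - F₀ a| ∂m) l (𝓝 0) := by
  -- Since `F i ≥ 0`, the part `(F₀ - F i)⁺` is dominated by `|F₀|`; then `|F i - F₀| = (F i - F₀) +
  -- 2 (F₀ - F i)⁺` is integrated.
  have h1 : Tendsto (fun i => ∫ a, max (F₀ a - F i a) 0 ∂m) l (𝓝 (∫ _, (0 : ℝ) ∂m)) := by
    refine tendsto_integral_filter_of_dominated_convergence (fun a => |F₀ a|) ?_ ?_ hF₀.abs ?_
    · filter_upwards [hF] with i hi
      exact ((hF₀.sub hi).sup (integrable_zero _ _ _)).aestronglyMeasurable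
    · refine Eventually.of_forall fun i => ae_of_all _ fun a => ?_
      rw [Real.norm_eq_abs, abs_of_nonneg (le_max_right _ _)]
      exact max_le (by linarith [le_abs_self (F₀ a), hpos i a]) (abs_nonneg _)
    · filter_upwards [hlim] with a ha
      have := (tendsto_const_nhds (x := F₀ a)).sub ha
      simpa using this.max (tendsto_const_nhds (x := (0 : ℝ)))
  rw [integral_zero] at h1
  have h2 := (hint.sub (tendsto_const_nhds (x := ∫ a, F₀ a ∂m))).add (h1.const_mul 2)
  rw [sub_self, mul_zero, add_zero] at h2
  refine h2.congr' ?_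
  filter_upwards [hF] with i hi
  have hm : Integrable (fun a => max (F₀ a - F i a) 0) m := (hF₀.sub hi).sup (integrable_zero _ _ _)
  have hd : Integrable (fun a => F i a - F₀ a) m := hi.sub hF₀
  rw [← integral_sub hi hF₀, ← integral_const_mul, ← integral_add hd (hm.const_mul 2)]
  refine integral_congr_ae (ae_of_all _ fun a => ?_)
  show F i a - F₀ a + 2 * max (F₀ a - F i a) 0 = |F i a - F₀ a|
  rcases le_total (F₀ a) (F i a) with h | h
  · rw [max_eq_right (by linarith), abs_of_nonneg (by linarith)]; ring
  · rw [max_eq_left (by linarith), abs_of_nonpos (by linarith)]; ring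

theorem integrable_sq_mul {g F : A → ℝ} (hg : Measurable g) (hF : Integrable F m)
    (hpos : ∀ a, 0 ≤ F a) {C : ℝ}
    (hC : ∫⁻ a, ENNReal.ofReal (g a ^ 2 * F a) ∂m ≤ ENNReal.ofReal C) :
    Integrable (fun a => g a ^ 2 * F a) m :=
  ⟨(hg.pow_const 2).aestronglyMeasurable.mul hF.1, (hasFiniteIntegral_iff_ofReal
    (ae_of_all _ fun a => mul_nonneg (sq_nonneg _) (hpos a))).2
      (lt_of_le_of_lt hC ENNReal.ofReal_lt_top)⟩

theorem integral_sq_mul_le {g F : A → ℝ} (hg : Measurable g) (hF : Integrable F m)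
    (hpos : ∀ a, 0 ≤ F a) {C : ℝ} (hC0 : 0 ≤ C)
    (hC : ∫⁻ a, ENNReal.ofReal (g a ^ 2 * F a) ∂m ≤ ENNReal.ofReal C) :
    ∫ a, g a ^ 2 * F a ∂m ≤ C := by
  rw [integral_eq_lintegral_of_nonneg_ae (ae_of_all _ fun a => mul_nonneg (sq_nonneg _) (hpos a))
    (integrable_sq_mul hg hF hpos hC).1]
  exact ENNReal.toReal_le_of_le_ofReal hC0 hC

theorem integrable_mul_of_sq {g F : A → ℝ} (hg : Measurable g) (hF : Integrable F m)
    (hpos : ∀ a, 0 ≤ F a) {C : ℝ}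
    (hC : ∫⁻ a, ENNReal.ofReal (g a ^ 2 * F a) ∂m ≤ ENNReal.ofReal C) :
    Integrable (fun a => g a * F a) m := by
  refine (hF.add (integrable_sq_mul hg hF hpos hC)).mono' (hg.aestronglyMeasurable.mul hF.1)
    (ae_of_all _ fun a => ?_)
  show |g a * F a| ≤ F a + g a ^ 2 * F a
  rw [abs_mul, abs_of_nonneg (hpos a), ← one_add_mul]
  refine mul_le_mul_of_nonneg_right ?_ (hpos a)
  nlinarith [sq_nonneg (|g a| - 1), sq_abs (g a)]

theorem abs_integral_mul_le {g F : A → ℝ} (hg : Measurable g) (hF : Integrable F m)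
    (hpos : ∀ a, 0 ≤ F a) {C : ℝ} (hC0 : 0 ≤ C)
    (hC : ∫⁻ a, ENNReal.ofReal (g a ^ 2 * F a) ∂m ≤ ENNReal.ofReal C) :
    |∫ a, g a * F a ∂m| ≤ ∫ a, F a ∂m + C := by
  have hsq := integrable_sq_mul hg hF hpos hC
  calc |∫ a, g a * F a ∂m| ≤ ∫ a, (F a + g a ^ 2 * F a) ∂m := by
        refine norm_integral_le_of_norm_le (f := fun a => g a * F a) (hF.add hsq)
          (ae_of_all _ fun a => ?_)
        show |g a * F a| ≤ F a + g a ^ 2 * F a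
        rw [abs_mul, abs_of_nonneg (hpos a), ← one_add_mul]
        refine mul_le_mul_of_nonneg_right ?_ (hpos a)
        nlinarith [sq_nonneg (|g a| - 1), sq_abs (g a)]
    _ ≤ _ := by
        rw [integral_add hF hsq]
        linarith [integral_sq_mul_le hg hF hpos hC0 hC]

/-- Fatou's lemma along a sequence tending to the countably generated filter `l`. -/
theorem lintegral_sq_mul_le_of_tendsto [l.NeBot] [l.IsCountablyGenerated] {g : A → ℝ}
    (hg : Measurable g) (hF : ∀ i, Measurable (F i)) {C : ENNReal}
    (hlim : ∀ᵐ a ∂m, Tendsto (fun i => F i a) l (𝓝 (F₀ a)))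
    (hC : ∀ᶠ i in l, ∫⁻ a, ENNReal.ofReal (g a ^ 2 * F i a) ∂m ≤ C) :
    ∫⁻ a, ENNReal.ofReal (g a ^ 2 * F₀ a) ∂m ≤ C := by
  obtain ⟨u, hu⟩ := exists_seq_tendsto l
  calc _ = ∫⁻ a, liminf (fun n => ENNReal.ofReal (g a ^ 2 * F (u n) a)) atTop ∂m := by
        refine lintegral_congr_ae (hlim.mono fun a ha => ?_)
        exact (((ENNReal.continuous_ofReal.tendsto _).comp
          ((ha.comp hu).const_mul (g a ^ 2))).liminf_eq).symm
    _ ≤ liminf (fun n => ∫⁻ a, ENNReal.ofReal (g a ^ 2 * F (u n) a) ∂m) atTop :=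
        lintegral_liminf_le fun n => by have := hF (u n); fun_prop
    _ ≤ C := liminf_le_of_frequently_le' (hu.eventually hC).frequently

/-- Bounded second moments make `g` uniformly integrable: `|g| ≤ T + g² / T` bounds the error by `T
‖F i - F₀‖₁ + 2 C / T` for every `T > 0`. -/
theorem tendsto_integral_mul_of_tendsto_L1 {g : A → ℝ} (hg : Measurable g)
    (hpos : ∀ i a, 0 ≤ F i a) (hpos₀ : ∀ a, 0 ≤ F₀ a) {C : ℝ} (hC0 : 0 ≤ C)
    (hF : ∀ᶠ i in l, Integrable (F i) m) (hF₀ : Integrable F₀ m)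
    (hC : ∀ᶠ i in l, ∫⁻ a, ENNReal.ofReal (g a ^ 2 * F i a) ∂m ≤ ENNReal.ofReal C)
    (hC₀ : ∫⁻ a, ENNReal.ofReal (g a ^ 2 * F₀ a) ∂m ≤ ENNReal.ofReal C)
    (hlim : Tendsto (fun i => ∫ a, |F i a - F₀ a| ∂m) l (𝓝 0)) :
    Tendsto (fun i => ∫ a, g a * F i a ∂m) l (𝓝 (∫ a, g a * F₀ a ∂m)) := by
  have key : ∀ T : ℝ, 0 < T → ∀ᶠ i in l, |∫ a, g a * F i a ∂m - ∫ a, g a * F₀ a ∂m| ≤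
      T * ∫ a, |F i a - F₀ a| ∂m + T⁻¹ * (C + C) := by
    intro T hT
    filter_upwards [hF, hC] with i hFi hCi
    have hs := integrable_sq_mul hg hFi (hpos i) hCi
    have hs₀ := integrable_sq_mul hg hF₀ hpos₀ hC₀
    have hd : Integrable (fun a => T * |F i a - F₀ a|) m := (hFi.sub hF₀).abs.const_mul T
    rw [← integral_sub (integrable_mul_of_sq hg hFi (hpos i) hCi)
      (integrable_mul_of_sq hg hF₀ hpos₀ hC₀)]
    calc _ ≤ ∫ a, (T * |F i a - F₀ a| + T⁻¹ * (g a ^ 2 * F i a + g a ^ 2 * F₀ a)) ∂m := by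
          refine norm_integral_le_of_norm_le (f := fun a => g a * F i a - g a * F₀ a)
            (hd.add ((hs.add hs₀).const_mul T⁻¹)) (ae_of_all _ fun a => ?_)
          show |g a * F i a - g a * F₀ a| ≤ _
          rw [← mul_sub, abs_mul]
          have h1 : |g a| ≤ T + T⁻¹ * g a ^ 2 := by
            have : T * (T + T⁻¹ * g a ^ 2) = T ^ 2 + g a ^ 2 := by field_simp
            nlinarith [sq_nonneg (|g a| - T), sq_abs (g a), abs_nonneg (g a)]
          have h2 : |F i a - F₀ a| ≤ F i a + F₀ a :=
            abs_le.2 ⟨by linarith [hpos i a, hpos₀ a], by linarith [hpos i a, hpos₀ a]⟩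
          calc _ ≤ (T + T⁻¹ * g a ^ 2) * |F i a - F₀ a| :=
                mul_le_mul_of_nonneg_right h1 (abs_nonneg _)
            _ ≤ T * |F i a - F₀ a| + T⁻¹ * g a ^ 2 * (F i a + F₀ a) := by
                rw [add_mul]; gcongr
            _ = _ := by ring
      _ ≤ _ := by
          have h3 : ∫ a, (T * |F i a - F₀ a| + T⁻¹ * (g a ^ 2 * F i a + g a ^ 2 * F₀ a)) ∂m =
              T * ∫ a, |F i a - F₀ a| ∂m +
                T⁻¹ * (∫ a, g a ^ 2 * F i a ∂m + ∫ a, g a ^ 2 * F₀ a ∂m) := by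
            rw [← integral_add hs hs₀, ← integral_const_mul, ← integral_const_mul]
            exact integral_add hd ((hs.add hs₀).const_mul T⁻¹)
          rw [h3]
          gcongr
          · exact integral_sq_mul_le hg hFi (hpos i) hC0 hCi
          · exact integral_sq_mul_le hg hF₀ hpos₀ hC0 hC₀
  rw [Metric.tendsto_nhds]
  intro ε hε
  -- This makes `2 C / T < ε / 2`; the `+ 1` keeps `T` positive when `C = 0`.
  set T := (4 * C + 1) / ε with hTdef
  have hT : 0 < T := by positivity
  have hsmall : T⁻¹ * (C + C) < ε / 2 := by
    rw [hTdef, inv_div, div_mul_eq_mul_div, div_lt_div_iff₀ (by positivity) (by norm_num)]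
    nlinarith
  filter_upwards [key T hT, (hlim.const_mul T).eventually_lt_const
    (show T * 0 < ε / 2 by rw [mul_zero]; positivity)] with i h1 h2
  rw [Real.dist_eq]
  linarith

end L1

/-- Uniform continuity on a compact set, inside the subtype `G`: continuity is needed only at points
of `S`, yet `y` may be any nearby point of `G`. -/
theorem exists_delta_of_continuousWithinAt {V W : Type*} [PseudoMetricSpace V] [PseudoMetricSpace W]
    {S G : Set V} (hS : IsCompact S) (hSG : S ⊆ G) {N : V → W}
    (hN : ∀ z ∈ S, ContinuousWithinAt N G z) {ε : ℝ} (hε : 0 < ε) :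
    ∃ δ > 0, ∀ z ∈ S, ∀ y ∈ G, dist z y < δ → dist (N z) (N y) < ε := by
  have hS' : IsCompact ((↑) ⁻¹' S : Set G) :=
    Topology.IsInducing.subtypeVal.isCompact_preimage_iff (by simpa using hSG) |>.2 hS
  have := hS'.uniformContinuousAt_of_continuousAt (G.domRestrict N)
    (fun a ha => continuousWithinAt_iff_continuousAt_domRestrict N a.2 |>.1 (hN a ha))
    (Metric.dist_mem_uniformity hε)
  obtain ⟨δ, hδ, h⟩ := Metric.mem_uniformity_dist.1 this
  exact ⟨δ, hδ, fun z hz y hy hd => h (a := ⟨z, hSG hz⟩) (b := ⟨y, hy⟩) hd hz⟩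

/-! ### The bias of convolution with a rescaled kernel. -/

section Bias

variable {V : Type*} [NormedAddCommGroup V] [NormedSpace ℝ V] [FiniteDimensional ℝ V]
  [MeasureSpace V] [BorelSpace V] [(volume : Measure V).IsAddHaarMeasure]

theorem integral_rescale (Φ : V → ℝ) {h : ℝ} (hh : 0 < h) (z : V) :
    ∫ y, (h ^ Module.finrank ℝ V)⁻¹ * Φ (h⁻¹ • (y - z)) = ∫ u, Φ u := by
  rw [integral_sub_right_eq_self (fun y => (h ^ Module.finrank ℝ V)⁻¹ * Φ (h⁻¹ • y)) z,
    integral_const_mul, Measure.integral_comp_inv_smul_of_nonneg _ _ hh.le, smul_eq_mul,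
    inv_mul_cancel_left₀ (by positivity)]

theorem integrable_rescale {Φ : V → ℝ} (hΦ : Integrable Φ) {h : ℝ} (hh : 0 < h) (z : V) :
    Integrable fun y => (h ^ Module.finrank ℝ V)⁻¹ * Φ (h⁻¹ • (y - z)) :=
  ((hΦ.comp_smul (inv_ne_zero hh.ne')).comp_sub_right z).const_mul _

set_option linter.unusedSectionVars false in
theorem tendsto_integral_tail {k : V → ℝ} (hk : Integrable k) {δ : ℝ} (hδ : 0 < δ) :
    Tendsto (fun h : ℝ => ∫ u, {u | δ ≤ ‖h • u‖}.indicator (fun u => |k u|) u) (𝓝 0) (𝓝 0) := by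
  have hm : ∀ h : ℝ, MeasurableSet {u : V | δ ≤ ‖h • u‖} := fun h =>
    measurableSet_le measurable_const (by fun_prop)
  have := tendsto_integral_filter_of_dominated_convergence (μ := (volume : Measure V))
    (l := 𝓝 (0 : ℝ))
    (F := fun h u => {u | δ ≤ ‖h • u‖}.indicator (fun u => |k u|) u) (f := fun _ => 0)
    (fun u => |k u|) (Eventually.of_forall fun h => (hk.abs.indicator (hm h)).aestronglyMeasurable)
    (Eventually.of_forall fun h => ae_of_all _ fun u => ?_) hk.abs (ae_of_all _ fun u => ?_)
  · simpa using this
  · refine (norm_indicator_le_norm_self _ _).trans ?_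
    simp
  · have h0 : Tendsto (fun h : ℝ => ‖h • u‖) (𝓝 0) (𝓝 0) := by
      have : Continuous fun h : ℝ => ‖h • u‖ := by fun_prop
      simpa using this.tendsto 0
    refine tendsto_const_nhds.congr' ?_
    filter_upwards [h0.eventually_lt_const hδ] with h hlt
    rw [Set.indicator_of_notMem]
    simpa using hlt

/-- Convolution with a rescaled kernel converges uniformly on a compact set `S`, for functions
that are bounded, and uniformly continuous at the points of `S`, up to a null set. -/
theorem exists_bandwidth_bias_le {k : V → ℝ} (hk : Integrable k) (hk1 : ∫ u, k u = 1)
    {S G : Set V} (hG : ∀ᵐ y, y ∈ G) (hSG : S ⊆ G) {N : V → ℝ}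
    (hN : ∀ ε : ℝ, 0 < ε → ∃ δ > 0, ∀ z ∈ S, ∀ y ∈ G, dist z y < δ → dist (N z) (N y) < ε)
    {C : ℝ} (hC : ∀ y ∈ G, |N y| ≤ C) {ε : ℝ} (hε : 0 < ε) :
    ∃ h₀ > 0, ∀ h, 0 < h → h < h₀ → ∀ z ∈ S,
      Integrable (fun y => (h ^ Module.finrank ℝ V)⁻¹ * k (h⁻¹ • (y - z)) * N y) →
      |(∫ y, (h ^ Module.finrank ℝ V)⁻¹ * k (h⁻¹ • (y - z)) * N y) - N z| < ε := by
  set κ := ∫ u, |k u| with hκ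
  have hκ0 : 0 ≤ κ := integral_nonneg fun u => abs_nonneg _
  obtain ⟨δ, hδ, hNδ⟩ := hN (ε / (2 * (κ + 1))) (by positivity)
  have htail := (tendsto_integral_tail hk hδ).const_mul (2 * C)
  rw [mul_zero] at htail
  obtain ⟨h₀, hh₀, htail⟩ := Metric.eventually_nhds_iff.1
    (htail.eventually_lt_const (half_pos hε))
  refine ⟨h₀, hh₀, fun h hh hlt z hz hint => ?_⟩
  have htail := htail (y := h) (by rwa [Real.dist_eq, sub_zero, abs_of_pos hh])
  set d := Module.finrank ℝ V
  -- Majorant after rescaling: the modulus of continuity at distance less than `δ`, the crude bound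
  -- `2 C` on the tail. The first part integrates to less than `ε / 2` by the choice of `δ`, the
  -- second by the choice of `h₀`.
  set Φ : V → ℝ := fun u => |k u| * (ε / (2 * (κ + 1))) +
    2 * C * {u | δ ≤ ‖h • u‖}.indicator (fun u => |k u|) u with hΦ
  have hind : Integrable fun u => {u : V | δ ≤ ‖h • u‖}.indicator (fun u => |k u|) u :=
    hk.abs.indicator (measurableSet_le measurable_const (by fun_prop))
  have hΦint : Integrable Φ := (hk.abs.mul_const _).add (hind.const_mul _)
  have h1 : (∫ y, (h ^ d)⁻¹ * k (h⁻¹ • (y - z)) * N y) - N z =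
      ∫ y, (h ^ d)⁻¹ * k (h⁻¹ • (y - z)) * (N y - N z) := by
    simp_rw [mul_sub]
    rw [integral_sub hint ((integrable_rescale hk hh z).mul_const _), integral_mul_const,
      integral_rescale k hh z, hk1, one_mul]
  have hNz : |N z| ≤ C := hC z (hSG hz)
  have h2 : |∫ y, (h ^ d)⁻¹ * k (h⁻¹ • (y - z)) * (N y - N z)| ≤
      ∫ y, (h ^ d)⁻¹ * Φ (h⁻¹ • (y - z)) := by
    refine norm_integral_le_of_norm_le (f := fun y => (h ^ d)⁻¹ * k (h⁻¹ • (y - z)) * (N y - N z))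
      (integrable_rescale hΦint hh z) ?_
    filter_upwards [hG] with y hy
    have hd : (0 : ℝ) < (h ^ d)⁻¹ := by positivity
    rw [Real.norm_eq_abs, abs_mul, abs_mul, abs_of_pos hd, mul_assoc]
    refine mul_le_mul_of_nonneg_left ?_ hd.le
    simp only [hΦ]
    by_cases hyz : δ ≤ ‖y - z‖
    · have hmem : h⁻¹ • (y - z) ∈ {u : V | δ ≤ ‖h • u‖} := by
        simpa [smul_inv_smul₀ hh.ne'] using hyz
      rw [Set.indicator_of_mem hmem]
      have : |N y - N z| ≤ 2 * C := by
        have := abs_sub (N y) (N z)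
        linarith [hC y hy]
      have h3 : 0 ≤ |k (h⁻¹ • (y - z))| * (ε / (2 * (κ + 1))) := by positivity
      nlinarith [mul_le_mul_of_nonneg_left this (abs_nonneg (k (h⁻¹ • (y - z))))]
    · have hmem : h⁻¹ • (y - z) ∉ {u : V | δ ≤ ‖h • u‖} := by
        simpa [smul_inv_smul₀ hh.ne'] using hyz
      rw [Set.indicator_of_notMem hmem, mul_zero, add_zero]
      have := hNδ z hz y hy (by rw [dist_comm, dist_eq_norm]; exact not_le.1 hyz)
      rw [dist_comm, Real.dist_eq] at this
      exact mul_le_mul_of_nonneg_left this.le (abs_nonneg _)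
  rw [integral_rescale Φ hh z, integral_add (hk.abs.mul_const _) (hind.const_mul _),
    integral_mul_const, integral_const_mul, ← hκ] at h2
  have h4 : κ * (ε / (2 * (κ + 1))) < ε / 2 := by
    rw [← mul_div_assoc, div_lt_div_iff₀ (by positivity) (by norm_num)]
    nlinarith
  rw [h1]
  linarith

end Bias

/-! ### Continuity of `numer`, and uniform deviation bounds for the kernel U-statistics. -/

section Numerator

set_option linter.unusedSectionVars false

variable {𝒳 : Type*} [MeasurableSpace 𝒳] {p k : ℕ} {μ : Measure 𝒳} [SigmaFinite μ]
  {f : 𝒳 → (Fin p → ℝ) → ℝ} {g : (Fin k → 𝒳) → ℝ} {𝒵 : Set (Fin p → ℝ)}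

/-- The product of the regression function `θ` and of the densities `f_Z(y i)`. -/
noncomputable def numer (μ : Measure 𝒳) (f : 𝒳 → (Fin p → ℝ) → ℝ) (g : (Fin k → 𝒳) → ℝ)
    (y : Fin k → Fin p → ℝ) : ℝ :=
  ∫ x, g x * prodDensity f x y ∂(Measure.pi fun _ => μ)

/-- The points where the mass and the second moment of `g` are at most `D` and `C`. -/
def goodPoints (μ : Measure 𝒳) (f : 𝒳 → (Fin p → ℝ) → ℝ) (g : (Fin k → 𝒳) → ℝ) (D C : ℝ) :
    Set (Fin k → Fin p → ℝ) :=
  {y | Integrable (fun x => prodDensity f x y) (Measure.pi fun _ => μ) ∧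
    ∫ x, prodDensity f x y ∂(Measure.pi fun _ => μ) ≤ D ∧
    ∫⁻ x, ENNReal.ofReal (g x ^ 2 * prodDensity f x y) ∂(Measure.pi fun _ => μ) ≤
      ENNReal.ofReal C}

theorem fZ_nonneg (hf0 : ∀ x z, 0 ≤ f x z) (z : Fin p → ℝ) : 0 ≤ fZ μ f z :=
  integral_nonneg fun x => hf0 x z

theorem integrable_prodDensity {y : Fin k → Fin p → ℝ}
    (hy : ∀ i, Integrable (fun x => f x (y i)) μ) :
    Integrable (fun x => prodDensity f x y) (Measure.pi fun _ => μ) :=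
  Integrable.fintype_prod (f := fun i x => f x (y i)) hy

theorem integral_prodDensity (y : Fin k → Fin p → ℝ) :
    ∫ x, prodDensity f x y ∂(Measure.pi fun _ => μ) = ∏ i, fZ μ f (y i) :=
  integral_fintype_prod_eq_prod (fun i x => f x (y i))

theorem numer_one (y : Fin k → Fin p → ℝ) :
    numer μ f (fun _ => 1) y = ∏ i, fZ μ f (y i) := by
  simp only [numer, one_mul, integral_prodDensity]

theorem theta_eq_div (z : Fin k → Fin p → ℝ) :
    theta μ f g z = numer μ f g z / numer μ f (fun _ => 1) z := by
  rw [numer_one, theta, numer, ← integral_div]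
  refine integral_congr_ae (ae_of_all _ fun x => ?_)
  simp only [condDensity, Finset.prod_div_distrib, prodDensity, mul_div_assoc]

theorem integral_prodDensity_le (hf0 : ∀ x z, 0 ≤ f x z) {fmax : ℝ}
    (hmax : ∀ z, fZ μ f z ≤ fmax) (y : Fin k → Fin p → ℝ) :
    ∫ x, prodDensity f x y ∂(Measure.pi fun _ => μ) ≤ fmax ^ k := by
  rw [integral_prodDensity]
  calc _ ≤ ∏ _i : Fin k, fmax := Finset.prod_le_prod (fun i _ => fZ_nonneg hf0 _) fun i _ => hmax _
    _ = _ := by simp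

theorem ae_mem_goodPoints (hf : Measurable (Function.uncurry f)) (hf0 : ∀ x z, 0 ≤ f x z)
    [IsProbabilityMeasure (pairLaw μ f)] {B : ℝ} (hB : MomentBound μ f g B) {fmax : ℝ}
    (hmax : ∀ z, fZ μ f z ≤ fmax) :
    ∀ᵐ y, y ∈ goodPoints μ f g (fmax ^ k) (2 * B ^ 2 * fmax ^ k) := by
  filter_upwards [ae_all_margDensity_ne_top (μ := μ) (k := k) hf, hB] with y hy hBy
  have hprod : ∏ i, margDensity μ f (y i) =
      ENNReal.ofReal (∫ x, prodDensity f x y ∂(Measure.pi fun _ => μ)) := by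
    rw [integral_prodDensity, ENNReal.ofReal_prod_of_nonneg fun i _ => fZ_nonneg hf0 _]
    exact Finset.prod_congr rfl fun i _ => margDensity_eq_of_ne_top hf hf0 (hy i)
  refine ⟨⟨(measurable_prodDensity_left hf y).aestronglyMeasurable,
    (hasFiniteIntegral_iff_ofReal (ae_of_all _ fun x => prodDensity_nonneg hf0 x y)).2 ?_⟩,
    integral_prodDensity_le hf0 hmax y, ?_⟩
  · rw [lintegral_prodDensity hf hf0, hprod]
    exact ENNReal.ofReal_lt_top
  -- The constant `2 * B ^ 2 * fmax ^ k` is the moment bound for `l = 2`, with `2! = 2` and mass at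
  -- most `fmax ^ k`.
  · have h2 := hBy 2
    rw [hprod, ← ENNReal.ofReal_mul (by positivity)] at h2
    simp only [sq_abs, ← ENNReal.ofReal_mul (sq_nonneg _)] at h2
    refine h2.trans (ENNReal.ofReal_le_ofReal ?_)
    have := mul_le_mul_of_nonneg_left (integral_prodDensity_le hf0 hmax y)
      (show 0 ≤ B ^ 2 * (Nat.factorial 2 : ℝ) by positivity)
    refine this.trans (le_of_eq ?_)
    rw [Nat.factorial_two]
    push_cast
    ring

theorem abs_numer_le (hf0 : ∀ x z, 0 ≤ f x z) (hg : Measurable g) {D C : ℝ} (hC : 0 ≤ C)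
    {y : Fin k → Fin p → ℝ} (hy : y ∈ goodPoints μ f g D C) : |numer μ f g y| ≤ D + C := by
  have := abs_integral_mul_le hg hy.1 (fun x => prodDensity_nonneg hf0 x y) hC hy.2.2
  exact this.trans (by linarith [hy.2.1])

/-- Scheffé's lemma: the densities converge pointwise by continuity of `f x`, their masses `∏
f_Z(y_i)` by continuity of `f_Z`; positivity of `f_Z` near `z i` supplies integrability. -/
theorem tendsto_L1_prodDensity (hf0 : ∀ x z, 0 ≤ f x z)
    {z : Fin k → Fin p → ℝ} (hcont : ∀ i, ContinuousAt (fZ μ f) (z i))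
    (hpos : ∀ i, 0 < fZ μ f (z i)) (hfx : ∀ i, ∀ᵐ x ∂μ, ContinuousAt (f x) (z i)) :
    (∀ᶠ y in 𝓝 z, Integrable (fun x => prodDensity f x y) (Measure.pi fun _ => μ)) ∧
    (∀ᵐ x ∂(Measure.pi fun _ : Fin k => μ),
      Tendsto (fun y => prodDensity f x y) (𝓝 z) (𝓝 (prodDensity f x z))) ∧
    Tendsto (fun y => ∫ x, |prodDensity f x y - prodDensity f x z| ∂(Measure.pi fun _ => μ))
      (𝓝 z) (𝓝 0) := by
  have hev : ∀ i, Tendsto (fun y : Fin k → Fin p → ℝ => y i) (𝓝 z) (𝓝 (z i)) := fun i =>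
    (continuous_apply i).tendsto z
  have h1 : ∀ᶠ y in 𝓝 z, Integrable (fun x => prodDensity f x y) (Measure.pi fun _ => μ) := by
    have : ∀ᶠ y in 𝓝 z, ∀ i, 0 < fZ μ f (y i) := eventually_all.2 fun i =>
      ((hcont i).tendsto.comp (hev i)).eventually_const_lt (hpos i)
    exact this.mono fun y hy => integrable_prodDensity fun i => integrable_of_fZ_pos (hy i)
  have h2 : ∀ᵐ x ∂(Measure.pi fun _ : Fin k => μ),
      Tendsto (fun y => prodDensity f x y) (𝓝 z) (𝓝 (prodDensity f x z)) := by
    have : ∀ᵐ x ∂(Measure.pi fun _ : Fin k => μ), ∀ i, ContinuousAt (f (x i)) (z i) :=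
      eventually_all.2 fun i => (Measure.quasiMeasurePreserving_eval (fun _ : Fin k => μ) i).ae
        (hfx i)
    filter_upwards [this] with x hx
    exact tendsto_finsetProd _ fun i _ => (hx i).tendsto.comp (hev i)
  refine ⟨h1, h2, tendsto_integral_abs_sub_of_tendsto_integral h1
    (integrable_prodDensity fun i => integrable_of_fZ_pos (hpos i))
    (fun y x => prodDensity_nonneg hf0 x y) h2 ?_⟩
  simp_rw [integral_prodDensity]
  exact tendsto_finsetProd _ fun i _ => (hcont i).tendsto.comp (hev i)

/-- The second-moment bound passes from nearby good points to `z` by Fatou's lemma. -/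
theorem mem_goodPoints_of_dense (hf : Measurable (Function.uncurry f)) (hf0 : ∀ x z, 0 ≤ f x z)
    (hg : Measurable g) {z : Fin k → Fin p → ℝ} (hcont : ∀ i, ContinuousAt (fZ μ f) (z i))
    (hpos : ∀ i, 0 < fZ μ f (z i)) (hfx : ∀ i, ∀ᵐ x ∂μ, ContinuousAt (f x) (z i))
    {fmax C : ℝ} (hmax : ∀ z, fZ μ f z ≤ fmax) (hG : Dense (goodPoints μ f g (fmax ^ k) C)) :
    z ∈ goodPoints μ f g (fmax ^ k) C := by
  obtain ⟨h1, h2, -⟩ := tendsto_L1_prodDensity hf0 hcont hpos hfx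
  have : (𝓝[goodPoints μ f g (fmax ^ k) C] z).NeBot := mem_closure_iff_nhdsWithin_neBot.1 (hG z)
  refine ⟨h1.self_of_nhds, integral_prodDensity_le hf0 hmax z,
    lintegral_sq_mul_le_of_tendsto (l := 𝓝[goodPoints μ f g (fmax ^ k) C] z)
      (F := fun y x => prodDensity f x y) hg (fun y => measurable_prodDensity_left hf y)
      (h2.mono fun x hx => hx.mono_left nhdsWithin_le_nhds) ?_⟩
  filter_upwards [self_mem_nhdsWithin] with y hy using hy.2.2

theorem continuousWithinAt_numer (hf0 : ∀ x z, 0 ≤ f x z)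
    (hg : Measurable g) {z : Fin k → Fin p → ℝ} (hcont : ∀ i, ContinuousAt (fZ μ f) (z i))
    (hpos : ∀ i, 0 < fZ μ f (z i)) (hfx : ∀ i, ∀ᵐ x ∂μ, ContinuousAt (f x) (z i))
    {D C : ℝ} (hC : 0 ≤ C) (hz : z ∈ goodPoints μ f g D C) :
    ContinuousWithinAt (numer μ f g) (goodPoints μ f g D C) z := by
  obtain ⟨h1, -, h3⟩ := tendsto_L1_prodDensity hf0 hcont hpos hfx
  exact tendsto_integral_mul_of_tendsto_L1 (F := fun y x => prodDensity f x y) hg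
    (fun y x => prodDensity_nonneg hf0 x y) (fun x => prodDensity_nonneg hf0 x z) hC
    (h1.filter_mono nhdsWithin_le_nhds) hz.1
    (by filter_upwards [self_mem_nhdsWithin] with y hy using hy.2.2) hz.2.2
    (h3.mono_left nhdsWithin_le_nhds)

/-- The good points have full Lebesgue measure, hence are dense, so that every point of `𝒵^k` is a
good one and a limit within good ones. -/
theorem continuousOn_numer (hf : Measurable (Function.uncurry f)) (hf0 : ∀ x z, 0 ≤ f x z)
    [IsProbabilityMeasure (pairLaw μ f)] (hg : Measurable g) {B : ℝ} (hB : MomentBound μ f g B)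
    {fmax : ℝ} (hmax : ∀ z, fZ μ f z ≤ fmax) (hcont : ∀ z ∈ 𝒵, ContinuousAt (fZ μ f) z)
    (hpos : ∀ z ∈ 𝒵, 0 < fZ μ f z) (hfx : ∀ z ∈ 𝒵, ∀ᵐ x ∂μ, ContinuousAt (f x) z) :
    (Set.univ.pi fun _ => 𝒵) ⊆ goodPoints μ f g (fmax ^ k) (2 * B ^ 2 * fmax ^ k) ∧
    ∀ z ∈ Set.univ.pi fun _ => 𝒵, ContinuousWithinAt (numer μ f g)
      (goodPoints μ f g (fmax ^ k) (2 * B ^ 2 * fmax ^ k)) z := by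
  have hfm : 0 ≤ fmax := (fZ_nonneg hf0 0).trans (hmax 0)
  have hdense : Dense (goodPoints μ f g (fmax ^ k) (2 * B ^ 2 * fmax ^ k)) :=
    Measure.dense_of_ae (ae_mem_goodPoints hf hf0 hB hmax)
  have hsub : (Set.univ.pi fun _ => 𝒵) ⊆ goodPoints μ f g (fmax ^ k) (2 * B ^ 2 * fmax ^ k) :=
    fun z hz => mem_goodPoints_of_dense hf hf0 hg (fun i => hcont _ (hz i trivial))
      (fun i => hpos _ (hz i trivial)) (fun i => hfx _ (hz i trivial)) hmax hdense
  exact ⟨hsub, fun z hz => continuousWithinAt_numer hf0 hg (fun i => hcont _ (hz i trivial))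
      (fun i => hpos _ (hz i trivial)) (fun i => hfx _ (hz i trivial)) (by positivity) (hsub hz)⟩

/-- The summand of the numerator of `θ̂`. -/
noncomputable def kernelTerm (K : (Fin p → ℝ) → ℝ) (h : ℝ) (g : (Fin k → 𝒳) → ℝ)
    (z : Fin k → Fin p → ℝ) (w : Fin k → 𝒳 × (Fin p → ℝ)) : ℝ :=
  (∏ i, scaledKernel K h ((w i).2 - z i)) * g fun i => (w i).1

theorem measurable_kernelTerm {K : (Fin p → ℝ) → ℝ} (hK : Measurable K) (hg : Measurable g) (h : ℝ)
    (z : Fin k → Fin p → ℝ) : Measurable (kernelTerm K h g z) := by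
  unfold kernelTerm scaledKernel
  fun_prop

/-- The product of the `k` kernels is a single kernel on `ℝ^{kp}` at scale `h`, to which the bias
bound applies. -/
theorem prod_scaledKernel (K : (Fin p → ℝ) → ℝ) (h : ℝ) (y z : Fin k → Fin p → ℝ) :
    ∏ i, scaledKernel K h (y i - z i) =
      (h ^ Module.finrank ℝ (Fin k → Fin p → ℝ))⁻¹ * ∏ i, K ((h⁻¹ • (y - z)) i) := by
  simp only [scaledKernel, Finset.prod_mul_distrib, Finset.prod_const, Finset.card_univ,
    Fintype.card_fin, Pi.smul_apply, Pi.sub_apply]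
  congr 1
  rw [Module.finrank_pi_fintype]
  simp [← pow_mul, mul_comm]

theorem lintegral_kernelTerm_pow_le (hf : Measurable (Function.uncurry f))
    (hf0 : ∀ x z, 0 ≤ f x z) [IsProbabilityMeasure (pairLaw μ f)] (hg : Measurable g) {B : ℝ}
    (hB : MomentBound μ f g B) {K : (Fin p → ℝ) → ℝ} {a : ℝ} (ha : ∀ u, |K u| ≤ a)
    {h : ℝ} (hh : 0 < h) (z : Fin k → Fin p → ℝ) (l : ℕ) :
    ∫⁻ w, ENNReal.ofReal (|kernelTerm K h g z w| ^ l) ∂(Measure.pi fun _ => pairLaw μ f) ≤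
      ENNReal.ofReal ((a ^ k * (h ^ (k * p))⁻¹ * B) ^ l * l.factorial) := by
  have ha0 : 0 ≤ a := (abs_nonneg _).trans (ha 0)
  have hbd : ∀ w : Fin k → 𝒳 × (Fin p → ℝ), |kernelTerm K h g z w| ≤
      a ^ k * (h ^ (k * p))⁻¹ * |g fun i => (w i).1| := by
    intro w
    rw [kernelTerm, abs_mul, Finset.abs_prod]
    refine mul_le_mul_of_nonneg_right ?_ (abs_nonneg _)
    calc _ ≤ ∏ _i : Fin k, ((h ^ p)⁻¹ * a) := by
          refine Finset.prod_le_prod (fun _ _ => abs_nonneg _) fun i _ => ?_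
          rw [scaledKernel, abs_mul, abs_of_pos (by positivity)]
          exact mul_le_mul_of_nonneg_left (ha _) (by positivity)
      _ = _ := by
          rw [Finset.prod_const, Finset.card_univ, Fintype.card_fin, mul_pow, inv_pow, ← pow_mul,
            mul_comm p k, mul_comm]
  calc _ ≤ ∫⁻ w, ENNReal.ofReal ((a ^ k * (h ^ (k * p))⁻¹) ^ l) *
        ENNReal.ofReal (|g fun i => (w i).1| ^ l) ∂(Measure.pi fun _ => pairLaw μ f) := by
        refine lintegral_mono fun w => ?_
        rw [← ENNReal.ofReal_mul (by positivity), ← mul_pow]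
        exact ENNReal.ofReal_le_ofReal (pow_le_pow_left₀ (abs_nonneg _) (hbd w) l)
    _ ≤ _ := by
        rw [lintegral_const_mul _ (by fun_prop), mul_pow _ B, mul_assoc,
          ENNReal.ofReal_mul (by positivity)]
        exact mul_le_mul_right (hB.lintegral_le hf hf0 hg l) _

/-- Integrating out `x` first leaves a convolution of `numer` with the rescaled product kernel. -/
theorem integral_kernelTerm (hf : Measurable (Function.uncurry f))
    (hf0 : ∀ x z, 0 ≤ f x z) [IsProbabilityMeasure (pairLaw μ f)] (hg : Measurable g) {B : ℝ}
    (hB : MomentBound μ f g B) {K : (Fin p → ℝ) → ℝ} (hK : Measurable K) {a : ℝ}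
    (ha : ∀ u, |K u| ≤ a) {h : ℝ} (hh : 0 < h) (z : Fin k → Fin p → ℝ) :
    Integrable (fun y => (h ^ Module.finrank ℝ (Fin k → Fin p → ℝ))⁻¹ *
      (∏ i, K ((h⁻¹ • (y - z)) i)) * numer μ f g y) ∧
    ∫ w, kernelTerm K h g z w ∂(Measure.pi fun _ => pairLaw μ f) =
      ∫ y, (h ^ Module.finrank ℝ (Fin k → Fin p → ℝ))⁻¹ *
        (∏ i, K ((h⁻¹ • (y - z)) i)) * numer μ f g y := by
  have hint : Integrable (kernelTerm K h g z) (Measure.pi fun _ => pairLaw μ f) := by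
    refine ⟨(measurable_kernelTerm hK hg h z).aestronglyMeasurable, ?_⟩
    rw [hasFiniteIntegral_iff_norm]
    refine lt_of_le_of_lt ?_ (lt_of_le_of_lt (lintegral_kernelTerm_pow_le hf hf0 hg hB ha hh z 1)
      ENNReal.ofReal_lt_top)
    simp
  obtain ⟨h1, h2⟩ := integral_pi_pairLaw hf hf0
    (Φ := fun q => (∏ i, scaledKernel K h (q.2 i - z i)) * g q.1) hint
  have h3 : ∀ y : Fin k → Fin p → ℝ, ∫ x, (∏ i, scaledKernel K h (y i - z i)) * g x *
      prodDensity f x y ∂(Measure.pi fun _ => μ) =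
      (h ^ Module.finrank ℝ (Fin k → Fin p → ℝ))⁻¹ *
        (∏ i, K ((h⁻¹ • (y - z)) i)) * numer μ f g y := fun y => by
    simp_rw [mul_assoc (∏ i, scaledKernel K h (y i - z i))]
    rw [integral_const_mul, prod_scaledKernel, numer]
  refine ⟨by simpa only [h3] using h1.integral_prod_right, ?_⟩
  simp only [h3] at h2
  exact h2

variable {Ω : Type*} [MeasurableSpace Ω] {P : Measure Ω} [IsProbabilityMeasure P]
  {X : ℕ → Ω → 𝒳} {Z : ℕ → Ω → Fin p → ℝ}

/-- Uniform concentration of the kernel U-statistics. -/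
theorem exists_kernel_deviation_bound (hX : ∀ i, Measurable (X i)) (hZ : ∀ i, Measurable (Z i))
    (hindep : iIndepFun (fun i ω => (X i ω, Z i ω)) P)
    (hlaw : ∀ i, P.map (fun ω => (X i ω, Z i ω)) = pairLaw μ f)
    (hf : Measurable (Function.uncurry f)) (hf0 : ∀ x z, 0 ≤ f x z)
    (hg : Measurable g) {B : ℝ} (hB0 : 0 ≤ B) (hB : MomentBound μ f g B) {fmax : ℝ}
    (hmax : ∀ z, fZ μ f z ≤ fmax) (h𝒵 : IsCompact 𝒵) (hcont : ∀ z ∈ 𝒵, ContinuousAt (fZ μ f) z)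
    (hpos : ∀ z ∈ 𝒵, 0 < fZ μ f z) (hfx : ∀ z ∈ 𝒵, ∀ᵐ x ∂μ, ContinuousAt (f x) z)
    {K : (Fin p → ℝ) → ℝ} (hK : Measurable K) {a : ℝ} (ha : ∀ u, |K u| ≤ a) (hKint : Integrable K)
    (hK1 : ∫ u, K u = 1) {t : ℝ} (ht : 0 < t) :
    ∃ c > 0, ∃ h₀ > 0, ∀ h, 0 < h → h < h₀ → ∀ m n : ℕ, m * k ≤ n → ∀ z : Fin k → Fin p → ℝ,
      (∀ i, z i ∈ 𝒵) → P {ω | t ≤ |(embAvg fun σ : Fin k ↪ Fin n =>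
        kernelTerm K h g z fun i => (X (σ i) ω, Z (σ i) ω)) - numer μ f g z|} ≤
        2 * ENNReal.ofReal (Real.exp (-(c * m * h ^ (2 * k * p)))) := by
  have : IsProbabilityMeasure (pairLaw μ f) := by
    rw [← hlaw 0]; exact Measure.isProbabilityMeasure_map ((hX 0).prodMk (hZ 0)).aemeasurable
  have ha0 : 0 ≤ a := (abs_nonneg _).trans (ha 0)
  have hfm : 0 ≤ fmax := (fZ_nonneg hf0 0).trans (hmax 0)
  obtain ⟨hSG, hN⟩ := continuousOn_numer hf hf0 hg hB hmax hcont hpos hfx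
  have hS : IsCompact (Set.univ.pi fun _ : Fin k => 𝒵) := isCompact_univ_pi fun _ => h𝒵
  -- Half of `t` is spent on the bias, the other half on the random deviation.
  obtain ⟨h₀, hh₀, hbias⟩ := exists_bandwidth_bias_le
    (k := fun u : Fin k → Fin p → ℝ => ∏ i, K (u i))
    (Integrable.fintype_prod (f := fun _ : Fin k => K) fun _ => hKint)
    (by rw [integral_fintype_prod_volume_eq_pow K, hK1, one_pow])
    (ae_mem_goodPoints hf hf0 hB hmax) hSG
    (fun ε hε => exists_delta_of_continuousWithinAt hS hSG hN hε)
    (fun y hy => abs_numer_le hf0 hg (by positivity) hy) (half_pos ht)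
  set A := a ^ k * B with hA
  have hA0 : 0 ≤ A := by positivity
  -- The Chernoff parameter will be `s = c H²` with `H = h ^ (k p) ≤ 1`. The moments are governed by
  -- `b = A / H`, so `s b = c A H`: the first bound on `c` keeps this at most `1/2`, the second
  -- makes `2 (s b)²` at most half of `s t / 2`, leaving the exponent `-(c t / 4) m H²`.
  set c := min (1 / (2 * (A + 1))) (t / (8 * (A ^ 2 + 1))) with hc
  have hc0 : 0 < c := by positivity
  have hc1 : c * A ≤ 1 / 2 := by
    have : c * (2 * (A + 1)) ≤ 1 := (le_div_iff₀ (by positivity)).1 (min_le_left _ _)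
    nlinarith
  have hc2 : 2 * c * A ^ 2 ≤ t / 4 := by
    have : c * (8 * (A ^ 2 + 1)) ≤ t := (le_div_iff₀ (by positivity)).1 (min_le_right _ _)
    nlinarith
  refine ⟨c * t / 4, by positivity, min h₀ 1, by positivity, fun h hh hlt m n hmn z hz => ?_⟩
  set H := h ^ (k * p) with hH
  have hH0 : 0 < H := by positivity
  have hH1 : H ≤ 1 := pow_le_one₀ hh.le (hlt.le.trans (min_le_right _ _))
  have hHsq : h ^ (2 * k * p) = H ^ 2 := by rw [hH, ← pow_mul]; congr 1; ring
  obtain ⟨hint, hmean⟩ := integral_kernelTerm hf hf0 hg hB hK ha hh z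
  have hb := hbias h hh (hlt.trans_le (min_le_left _ _)) z (fun i _ => hz i) hint
  rw [← hmean] at hb
  have hsb : c * H ^ 2 * (a ^ k * H⁻¹ * B) = c * A * H := by
    rw [hA]; field_simp
  have hdev := measure_embAvg_deviation_le (P := P) (W := fun i ω => (X i ω, Z i ω))
    (fun i => (hX i).prodMk (hZ i)) hindep hlaw hmn (measurable_kernelTerm hK hg h z)
    (b := a ^ k * H⁻¹ * B) (by positivity)
    (fun l => lintegral_kernelTerm_pow_le hf hf0 hg hB ha hh z l)
    (s := c * H ^ 2) (by positivity) (by rw [hsb]; nlinarith) (t / 2)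
  refine (measure_mono fun ω hω => ?_).trans (hdev.trans (mul_le_mul_right
    (ENNReal.ofReal_le_ofReal (Real.exp_le_exp.2 ?_)) _))
  · have hω' : t ≤ |_| := hω
    show t / 2 ≤ |_|
    have := abs_sub_le (embAvg fun σ : Fin k ↪ Fin n =>
        kernelTerm K h g z fun i => (X (σ i) ω, Z (σ i) ω))
        (∫ w, kernelTerm K h g z w ∂(Measure.pi fun _ => pairLaw μ f)) (numer μ f g z)
    linarith
  · rw [hsb, hHsq]
    have h1 : 2 * (c * A * H) ^ 2 - c * H ^ 2 * (t / 2) ≤ -(c * t / 4 * H ^ 2) := by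
      have := mul_le_mul_of_nonneg_left hc2 (show 0 ≤ c * H ^ 2 by positivity)
      nlinarith
    have := mul_le_mul_of_nonneg_left h1 (Nat.cast_nonneg (α := ℝ) m)
    linarith

end Numerator

/-! ### Stability of minimizers of convex functions. -/

section ConvexArgmin

/-- On the compact set `T` at distance exactly `ε` from the minimizers, `G` exceeds its minimum by a
positive gap. A minimizer `b` of `F` farther away would be joined to `s` by a segment crossing `T`,
where convexity forces `F ≤ F s`; this contradicts closeness of `F` to `G` within a third of the
gap. -/
theorem exists_stability_argminSet {E : Type*} [NormedAddCommGroup E] [NormedSpace ℝ E]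
    [ProperSpace E] {G : E → ℝ} (hG : Continuous G) (hS : IsCompact (argminSet G))
    (hne : (argminSet G).Nonempty) {ε : ℝ} (hε : 0 < ε) :
    ∃ δ > 0, ∃ R : ℝ, ∀ F : E → ℝ, ConvexOn ℝ Set.univ F →
      (∀ β, ‖β‖ ≤ R → |F β - G β| ≤ δ) → ∀ b ∈ argminSet F,
        Metric.infDist b (argminSet G) < ε := by
  obtain ⟨s, hs⟩ := hne
  set T := {β | Metric.infDist β (argminSet G) = ε} with hT
  have hTclosed : IsClosed T := isClosed_eq (Metric.continuous_infDist_pt _) continuous_const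
  have hcth : IsCompact (Metric.cthickening ε (argminSet G)) := hS.cthickening
  have hTsub : T ⊆ Metric.cthickening ε (argminSet G) := fun β hβ => by
    rw [Metric.cthickening_eq_preimage_infEDist]
    refine ENNReal.le_ofReal_iff_toReal_le ?_ hε.le |>.2 (le_of_eq hβ)
    exact Metric.infEDist_ne_top ⟨s, hs⟩
  have hTc : IsCompact T := hcth.of_isClosed_subset hTclosed hTsub
  obtain ⟨R, hR⟩ := hcth.isBounded.exists_norm_le
  have hsR : ‖s‖ ≤ R := hR s (Metric.self_subset_cthickening _ hs)
  have hcross : ∀ b, ε ≤ Metric.infDist b (argminSet G) → ∃ b' ∈ T, b' ∈ segment ℝ s b := by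
    intro b hb
    have hcont : ContinuousOn (fun t : ℝ => Metric.infDist (AffineMap.lineMap s b t)
        (argminSet G)) (Set.Icc 0 1) :=
      ((Metric.continuous_infDist_pt _).comp AffineMap.lineMap_continuous).continuousOn
    obtain ⟨t, ht, hval⟩ := intermediate_value_Icc zero_le_one hcont
      (show ε ∈ Set.Icc _ _ by
        simpa [Metric.infDist_zero_of_mem hs] using ⟨hε.le, hb⟩)
    exact ⟨_, hval, by rw [segment_eq_image_lineMap]; exact ⟨t, ht, rfl⟩⟩
  -- If `T` is empty, no point lies at distance `ε` or more, and nothing is required of `F`.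
  rcases T.eq_empty_or_nonempty with hTe | hTne
  · refine ⟨1, one_pos, R, fun F _ _ b _ => ?_⟩
    by_contra! hb
    obtain ⟨b', hb', -⟩ := hcross b hb
    rw [hTe] at hb'
    exact hb'
  obtain ⟨β₀, hβ₀, hmin⟩ := hTc.exists_isMinOn hTne hG.continuousOn
  have hgap : 0 < G β₀ - G s := by
    by_contra! h
    have : β₀ ∈ argminSet G := fun b' => by linarith [hs b']
    have h0 := Metric.infDist_zero_of_mem this
    rw [show Metric.infDist β₀ (argminSet G) = ε from hβ₀] at h0
    exact hε.ne' h0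
  refine ⟨(G β₀ - G s) / 3, by positivity, R, fun F hF hFG b hb => ?_⟩
  by_contra! hfar
  obtain ⟨b', hb', hseg⟩ := hcross b hfar
  have h1 := hF.le_max_of_mem_segment (Set.mem_univ s) (Set.mem_univ b) hseg
  rw [max_eq_left (hb s)] at h1
  have h2 := abs_le.1 (hFG b' (hR b' (hTsub hb')))
  have h3 := abs_le.1 (hFG s hsR)
  have h4 : G β₀ ≤ G b' := hmin hb'
  linarith [h2.1, h3.2]

end ConvexArgmin

/-! ### The lasso criterion and its limit. -/

section Criterion

variable {p k r : ℕ}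

theorem gramMatrix_quadratic {n' : ℕ} (ψ : (Fin k → Fin p → ℝ) → Fin r → ℝ)
    (z' : Fin n' → Fin p → ℝ) (I : Finset (Fin k ↪ Fin n')) (v : Fin r → ℝ) :
    v ⬝ᵥ (gramMatrix ψ z' I).mulVec v =
      (I.card : ℝ)⁻¹ * ∑ σ ∈ I, (ψ (fun i => z' (σ i)) ⬝ᵥ v) ^ 2 := by
  rw [gramMatrix, Matrix.smul_mulVec, dotProduct_smul, smul_eq_mul, Matrix.sum_mulVec,
    dotProduct_sum]
  congr 1
  refine Finset.sum_congr rfl fun σ _ => ?_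
  rw [Matrix.vecMulVec_mulVec]
  simp [dotProduct_comm v, sq]

theorem gramMatrix_transpose {n' : ℕ} (ψ : (Fin k → Fin p → ℝ) → Fin r → ℝ)
    (z' : Fin n' → Fin p → ℝ) (I : Finset (Fin k ↪ Fin n')) :
    (gramMatrix ψ z' I).transpose = gramMatrix ψ z' I := by
  simp [gramMatrix, Matrix.transpose_smul, Matrix.transpose_sum, Matrix.transpose_vecMulVec]

theorem abs_dotProduct_le (u v : Fin r → ℝ) : |u ⬝ᵥ v| ≤ r * ‖u‖ * ‖v‖ := by
  calc |u ⬝ᵥ v| ≤ ∑ j, |u j * v j| := Finset.abs_sum_le_sum_abs _ _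
    _ ≤ ∑ _j : Fin r, ‖u‖ * ‖v‖ := Finset.sum_le_sum fun j _ => by
        rw [abs_mul]
        exact mul_le_mul (norm_le_pi_norm u j) (norm_le_pi_norm v j) (abs_nonneg _) (norm_nonneg _)
    _ = _ := by simp [mul_assoc]

/-- With exact responses `ψᵀβ*` the criterion is the limit criterion for the empirical Gram matrix.
An error `e` in a response changes its term by `(e + d)² - d² = e² + 2 e d`, with `d = ψᵀ(β* - β)`.
-/
theorem abs_lassoCriterion_sub_le {n' : ℕ} {ψ : (Fin k → Fin p → ℝ) → Fin r → ℝ}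
    {z' : Fin n' → Fin p → ℝ} {I : Finset (Fin k ↪ Fin n')} {y : (Fin k ↪ Fin n') → ℝ}
    (lam : ℝ) {βstar : Fin r → ℝ} {η Cψ : ℝ} (hη : 0 ≤ η) (hCψ0 : 0 ≤ Cψ)
    (hψ : ∀ σ ∈ I, ‖ψ fun i => z' (σ i)‖ ≤ Cψ)
    (hy : ∀ σ ∈ I, |y σ - ψ (fun i => z' (σ i)) ⬝ᵥ βstar| ≤ η) (β : Fin r → ℝ) :
    |lassoCriterion ψ z' I y lam β - limitCriterion (gramMatrix ψ z' I) βstar lam β| ≤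
      η ^ 2 + 2 * η * (r * Cψ * ‖βstar - β‖) := by
  rw [lassoCriterion, limitCriterion, gramMatrix_quadratic, add_sub_add_right_eq_sub, ← mul_sub,
    ← Finset.sum_sub_distrib, abs_mul, abs_of_nonneg (by positivity : (0 : ℝ) ≤ (I.card : ℝ)⁻¹)]
  have hterm : ∀ σ ∈ I, |(y σ - ψ (fun i => z' (σ i)) ⬝ᵥ β) ^ 2 -
      (ψ (fun i => z' (σ i)) ⬝ᵥ (βstar - β)) ^ 2| ≤ η ^ 2 + 2 * η * (r * Cψ * ‖βstar - β‖) := by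
    intro σ hσ
    set e := y σ - ψ (fun i => z' (σ i)) ⬝ᵥ βstar with he
    set d := ψ (fun i => z' (σ i)) ⬝ᵥ (βstar - β) with hd
    have h1 : y σ - ψ (fun i => z' (σ i)) ⬝ᵥ β = e + d := by
      rw [he, hd, dotProduct_sub]; ring
    have hdle : |d| ≤ r * Cψ * ‖βstar - β‖ :=
      (abs_dotProduct_le _ _).trans (by gcongr; exact hψ σ hσ)
    have hele := hy σ hσ
    calc _ = |e ^ 2 + 2 * (e * d)| := by rw [h1]; congr 1; ring
      _ ≤ |e ^ 2| + |2 * (e * d)| := abs_add_le _ _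
      _ = |e| ^ 2 + 2 * (|e| * |d|) := by rw [abs_pow, abs_mul, abs_mul, abs_two]
      _ ≤ η ^ 2 + 2 * (η * (r * Cψ * ‖βstar - β‖)) := by gcongr
      _ = _ := by ring
  have hb : 0 ≤ η ^ 2 + 2 * η * (r * Cψ * ‖βstar - β‖) := by positivity
  calc _ ≤ (I.card : ℝ)⁻¹ * ∑ σ ∈ I, |(y σ - ψ (fun i => z' (σ i)) ⬝ᵥ β) ^ 2 -
        (ψ (fun i => z' (σ i)) ⬝ᵥ (βstar - β)) ^ 2| := by
        gcongr; exact Finset.abs_sum_le_sum_abs _ _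
    _ ≤ (I.card : ℝ)⁻¹ * (I.card * (η ^ 2 + 2 * η * (r * Cψ * ‖βstar - β‖))) := by
        gcongr
        exact (Finset.sum_le_card_nsmul I _ _ hterm).trans_eq (nsmul_eq_mul _ _)
    _ ≤ _ := by
        rw [← mul_assoc]
        -- An inequality, because `card⁻¹ * card` is `0` when the collection is empty.
        exact mul_le_of_le_one_left hb inv_mul_le_one

theorem convexOn_lassoCriterion {n' : ℕ} (ψ : (Fin k → Fin p → ℝ) → Fin r → ℝ)
    (z' : Fin n' → Fin p → ℝ) (I : Finset (Fin k ↪ Fin n')) (y : (Fin k ↪ Fin n') → ℝ)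
    {lam : ℝ} (hlam : 0 ≤ lam) : ConvexOn ℝ Set.univ (lassoCriterion ψ z' I y lam) := by
  refine ⟨convex_univ, fun u _ v _ a b ha hb hab => ?_⟩
  have h1 : ∀ σ ∈ I, (y σ - ψ (fun i => z' (σ i)) ⬝ᵥ (a • u + b • v)) ^ 2 ≤
      a * (y σ - ψ (fun i => z' (σ i)) ⬝ᵥ u) ^ 2 + b * (y σ - ψ (fun i => z' (σ i)) ⬝ᵥ v) ^ 2 := by
    intro σ _
    rw [dotProduct_add, dotProduct_smul, dotProduct_smul, smul_eq_mul, smul_eq_mul]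
    obtain rfl : b = 1 - a := by linarith
    nlinarith [mul_nonneg (mul_nonneg ha hb) (sq_nonneg (ψ (fun i => z' (σ i)) ⬝ᵥ u -
      ψ (fun i => z' (σ i)) ⬝ᵥ v))]
  have h2 : ∀ j ∈ (Finset.univ : Finset (Fin r)), |(a • u + b • v) j| ≤ a * |u j| + b * |v j| := by
    intro j _
    simp only [Pi.add_apply, Pi.smul_apply, smul_eq_mul]
    refine (abs_add_le _ _).trans ?_
    rw [abs_mul, abs_mul, abs_of_nonneg ha, abs_of_nonneg hb]
  have h3 := mul_le_mul_of_nonneg_left (Finset.sum_le_sum h1)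
    (by positivity : (0 : ℝ) ≤ (I.card : ℝ)⁻¹)
  have h4 := mul_le_mul_of_nonneg_left (Finset.sum_le_sum h2) hlam
  rw [Finset.sum_add_distrib, ← Finset.mul_sum, ← Finset.mul_sum] at h3 h4
  simp only [lassoCriterion, smul_eq_mul]
  linarith

theorem continuous_limitCriterion (βstar : Fin r → ℝ) :
    Continuous fun q : (Matrix (Fin r) (Fin r) ℝ × ℝ) × (Fin r → ℝ) =>
      limitCriterion q.1.1 βstar q.1.2 q.2 := by
  unfold limitCriterion
  fun_prop

/-- Joint continuity in `(M, lam, β)` and the tube lemma over the compact ball. -/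
theorem eventually_limitCriterion_near (M : Matrix (Fin r) (Fin r) ℝ) (βstar : Fin r → ℝ)
    (lam₀ R : ℝ) {δ : ℝ} (hδ : 0 < δ) :
    ∀ᶠ q : Matrix (Fin r) (Fin r) ℝ × ℝ in 𝓝 (M, lam₀), ∀ β, ‖β‖ ≤ R →
      |limitCriterion q.1 βstar q.2 β - limitCriterion M βstar lam₀ β| < δ := by
  have hK : IsCompact (Metric.closedBall (0 : Fin r → ℝ) R) := isCompact_closedBall _ _
  have := hK.eventually_forall_of_forall_eventually (x₀ := (M, lam₀))
    (P := fun q β => |limitCriterion q.1 βstar q.2 β - limitCriterion M βstar lam₀ β| < δ) ?_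
  · exact this.mono fun q hq β hβ => hq β (by simpa using hβ)
  · intro β _
    have hc : Continuous fun q : (Matrix (Fin r) (Fin r) ℝ × ℝ) × (Fin r → ℝ) =>
        |limitCriterion q.1.1 βstar q.1.2 q.2 - limitCriterion M βstar lam₀ q.2| :=
      ((continuous_limitCriterion βstar).sub ((continuous_limitCriterion βstar).comp
        (by fun_prop : Continuous fun q : (Matrix (Fin r) (Fin r) ℝ × ℝ) × (Fin r → ℝ) =>
          ((M, lam₀), q.2)))).abs
    exact hc.continuousAt.eventually_lt_const (by simpa using hδ)

variable {M : Matrix (Fin r) (Fin r) ℝ} {βstar : Fin r → ℝ} {lam₀ : ℝ}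

theorem continuous_limitCriterion_right : Continuous (limitCriterion M βstar lam₀) :=
  (continuous_limitCriterion βstar).comp
    (by fun_prop : Continuous fun β : Fin r → ℝ => ((M, lam₀), β))

theorem isClosed_argminSet {E : Type*} [TopologicalSpace E] {G : E → ℝ} (hG : Continuous G) :
    IsClosed (argminSet G) := by
  have : argminSet G = ⋂ b', {b | G b ≤ G b'} := by ext b; simp [argminSet]
  rw [this]
  exact isClosed_iInter fun b' => isClosed_le hG continuous_const

theorem limitCriterion_ge (hM : ∀ v : Fin r → ℝ, 0 ≤ v ⬝ᵥ M.mulVec v) (hlam : 0 ≤ lam₀)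
    (β : Fin r → ℝ) : lam₀ * ‖β‖ ≤ limitCriterion M βstar lam₀ β := by
  have h1 : ‖β‖ ≤ ∑ j, |β j| := (pi_norm_le_iff_of_nonneg
    (Finset.sum_nonneg fun _ _ => abs_nonneg _)).2 fun j =>
      Finset.single_le_sum (f := fun j => |β j|) (fun _ _ => abs_nonneg _) (Finset.mem_univ j)
  have := mul_le_mul_of_nonneg_left h1 hlam
  rw [limitCriterion]
  linarith [hM (βstar - β)]

/-- The penalty makes the criterion coercive: its sublevel set at `G 0` lies in the ball of radius
`G 0 / lam₀`. -/
theorem argminSet_limitCriterion_of_pos (hM : ∀ v : Fin r → ℝ, 0 ≤ v ⬝ᵥ M.mulVec v)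
    (hlam : 0 < lam₀) : IsCompact (argminSet (limitCriterion M βstar lam₀)) ∧
      (argminSet (limitCriterion M βstar lam₀)).Nonempty := by
  set G := limitCriterion M βstar lam₀ with hG
  have hcont : Continuous G := continuous_limitCriterion_right
  have hge : ∀ β, lam₀ * ‖β‖ ≤ G β := limitCriterion_ge hM hlam.le
  have hball : ∀ β, G β ≤ G 0 → β ∈ Metric.closedBall (0 : Fin r → ℝ) (G 0 / lam₀) := fun β hβ => by
    rw [mem_closedBall_zero_iff, le_div_iff₀ hlam, mul_comm]
    exact (hge β).trans hβ
  refine ⟨(isCompact_closedBall _ _).of_isClosed_subset (isClosed_argminSet hcont)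
    fun β hβ => hball β (hβ 0), ?_⟩
  obtain ⟨b, -, hb⟩ := (isCompact_closedBall (0 : Fin r → ℝ) (G 0 / lam₀)).exists_isMinOn
    ⟨0, hball 0 le_rfl⟩ hcont.continuousOn
  refine ⟨b, fun b' => ?_⟩
  by_cases h : G b' ≤ G 0
  · exact hb (hball b' h)
  · exact (hb (hball 0 le_rfl)).trans (not_le.1 h).le

theorem mem_argminSet_limitCriterion_zero (hM : ∀ v : Fin r → ℝ, 0 ≤ v ⬝ᵥ M.mulVec v) :
    βstar ∈ argminSet (limitCriterion M βstar 0) := fun b' => by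
  simpa [limitCriterion] using hM (βstar - b')

/-- A symmetric, positive semidefinite, invertible `M` is definite, so the quadratic form vanishes
only at `β = β*`. -/
theorem argminSet_limitCriterion_zero (hM : ∀ v : Fin r → ℝ, 0 ≤ v ⬝ᵥ M.mulVec v)
    (hsymm : M.transpose = M) (hdet : IsUnit M.det) :
    argminSet (limitCriterion M βstar 0) = {βstar} := by
  refine Set.Subset.antisymm (fun b hb => ?_)
    (Set.singleton_subset_iff.2 (mem_argminSet_limitCriterion_zero hM))
  have h0 : (βstar - b) ⬝ᵥ M.mulVec (βstar - b) = 0 :=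
    le_antisymm (by simpa [limitCriterion] using hb βstar) (hM _)
  have hpsd : M.PosSemidef := Matrix.PosSemidef.of_dotProduct_mulVec_nonneg
    (by rw [Matrix.IsHermitian, Matrix.conjTranspose_eq_transpose_of_trivial, hsymm])
    (by simpa using hM)
  have h1 : M.mulVec (βstar - b) = 0 := by
    refine (hpsd.dotProduct_mulVec_zero_iff _).1 ?_
    simpa using h0
  have h2 : βstar - b = 0 := by
    refine (Matrix.mulVec_injective_iff_isUnit.2 ((Matrix.isUnit_iff_isUnit_det M).2 hdet)) ?_
    rw [h1, Matrix.mulVec_zero]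
  exact (sub_eq_zero.1 h2).symm

end Criterion

/-! ### From the U-statistics to the estimator, simultaneously at all design points. -/

/-- Quotients close to `N₁ / N₂` stay in the region where a continuous link is controlled. -/
theorem exists_delta_link {V : Type*} [PseudoMetricSpace V] {S : Set V} (hS : IsCompact S)
    {N₁ N₂ : V → ℝ} (h₁ : ContinuousOn N₁ S) (h₂ : ContinuousOn N₂ S) (hpos : ∀ z ∈ S, 0 < N₂ z)
    {Λ : ℝ → ℝ} (hΛ : ∀ z ∈ S, ContinuousAt Λ (N₁ z / N₂ z)) {η : ℝ} (hη : 0 < η) :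
    ∃ t > 0, ∀ z ∈ S, ∀ a b : ℝ, |a - N₁ z| < t → |b - N₂ z| < t →
      0 < b ∧ |Λ (a / b) - Λ (N₁ z / N₂ z)| < η := by
  set T := (fun z => (N₁ z, N₂ z)) '' S with hT
  have hTc : IsCompact T := hS.image_of_continuousOn (h₁.prodMk h₂)
  have hTpos : T ⊆ {q : ℝ × ℝ | 0 < q.2} := by
    rintro _ ⟨z, hz, rfl⟩
    exact hpos z hz
  -- The pairs of limits form a compact subset of the half-plane of positive denominators; a
  -- thickening of it stays there, so that `θ̂` is well defined.
  obtain ⟨t₁, ht₁, hsub⟩ := hTc.exists_thickening_subset_open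
    (isOpen_lt continuous_const continuous_snd) hTpos
  have hcont : ∀ q ∈ T, ContinuousWithinAt (fun q : ℝ × ℝ => Λ (q.1 / q.2)) Set.univ q := by
    rintro _ ⟨z, hz, rfl⟩
    rw [continuousWithinAt_univ]
    exact ContinuousAt.comp (f := fun q : ℝ × ℝ => q.1 / q.2) (hΛ z hz)
      (continuousAt_fst.div₀ continuousAt_snd (hpos z hz).ne')
  obtain ⟨t₂, ht₂, hclose⟩ := exists_delta_of_continuousWithinAt hTc (Set.subset_univ _) hcont hη
  refine ⟨min t₁ t₂, lt_min ht₁ ht₂, fun z hz a b ha hb => ?_⟩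
  have hd : dist (N₁ z, N₂ z) (a, b) < min t₁ t₂ := by
    rw [Prod.dist_eq, max_lt_iff, dist_comm, Real.dist_eq, dist_comm, Real.dist_eq]
    exact ⟨ha, hb⟩
  have hmem : (N₁ z, N₂ z) ∈ T := ⟨z, hz, rfl⟩
  have hb0 : (a, b) ∈ {q : ℝ × ℝ | 0 < q.2} := hsub (Metric.mem_thickening_iff.2
    ⟨_, hmem, by rw [dist_comm]; exact hd.trans_le (min_le_left _ _)⟩)
  refine ⟨hb0, ?_⟩
  have := hclose _ hmem (a, b) (Set.mem_univ _) (hd.trans_le (min_le_right _ _))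
  rwa [dist_comm, Real.dist_eq] at this

/-- The number of injections cancels in the quotient; a positive average shows that it is not zero.
-/
theorem thetaHatDenom_pos_of_embAvg {𝒳 : Type*} {p k n : ℕ} {K : (Fin p → ℝ) → ℝ} {h : ℝ}
    {Xs : Fin n → 𝒳} {Zs : Fin n → Fin p → ℝ} {z : Fin k → Fin p → ℝ} (g : (Fin k → 𝒳) → ℝ)
    (hpos : 0 < embAvg fun σ : Fin k ↪ Fin n =>
      kernelTerm K h (fun _ => 1) z fun i => (Xs (σ i), Zs (σ i))) :
    0 < thetaHatDenom K h Zs z ∧ thetaHat K h g Xs Zs z =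
      (embAvg fun σ : Fin k ↪ Fin n => kernelTerm K h g z fun i => (Xs (σ i), Zs (σ i))) /
        embAvg fun σ : Fin k ↪ Fin n =>
          kernelTerm K h (fun _ => 1) z fun i => (Xs (σ i), Zs (σ i)) := by
  have hc : 0 ≤ (Fintype.card (Fin k ↪ Fin n) : ℝ)⁻¹ := by positivity
  simp only [embAvg, kernelTerm, mul_one] at hpos ⊢
  have hc' : (Fintype.card (Fin k ↪ Fin n) : ℝ)⁻¹ ≠ 0 := fun h0 => by
    rw [h0, zero_mul] at hpos
    exact hpos.false
  refine ⟨pos_of_mul_pos_right hpos hc, ?_⟩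
  rw [mul_div_mul_left _ _ hc']
  rfl

/-- The derivative of order zero is differentiable, hence continuous, at `z`, and `F` is its value
on the empty tuple. -/
theorem DifferentiableUpTo.continuousAt {p α : ℕ} (hα : 0 < α) {F : (Fin p → ℝ) → ℝ}
    {z : Fin p → ℝ} (h : DifferentiableUpTo α F z) : ContinuousAt F z := by
  have h0 := (h 0 hα).1.continuousAt
  have : F = fun w => ContinuousMultilinearMap.apply ℝ (fun _ : Fin 0 => Fin p → ℝ) ℝ 0
      (iteratedFDeriv ℝ 0 F w) := by
    ext w
    simp
  rw [this]
  exact (ContinuousLinearMap.continuous _).continuousAt.comp h0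

/-- As `∫ K = 1`, some `u` has `K u ≠ 0`; taking `t = 0` puts `z` itself in the open set. -/
theorem DensitySmoothness.continuousAt {p k α : ℕ} {K : (Fin p → ℝ) → ℝ} {𝒵 : Set (Fin p → ℝ)}
    {q : (Fin p → ℝ) → ℝ} (hK1 : ∫ u, K u = 1) (h : DensitySmoothness k K α 𝒵 q) :
    ∀ z ∈ 𝒵, ContinuousAt q z := by
  obtain ⟨⟨U, hU, hq, hzU⟩, -⟩ := h
  obtain ⟨u, hu⟩ : ∃ u, K u ≠ 0 := by
    by_contra! h0
    simp [h0] at hK1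
  intro z hz
  have hmem : z ∈ U := by simpa using hzU z hz u hu 0 (by simp)
  exact hq.continuousOn.continuousAt (hU.mem_nhds hmem)

/-- Under the rate condition, exponential bounds at `n'^k` design points are negligible. -/
theorem tendsto_union_bound {k p : ℕ} (hk : 0 < k) {L : Filter (ℕ × ℕ)} (hL : L ≤ atTop ×ˢ atTop)
    {h : ℕ → ℕ → ℝ} (hh : ∀ n n', 0 < h n n')
    (hrate : ∀ A : ℝ, 0 < A → Tendsto
      (fun N : ℕ × ℕ => (N.2 : ℝ) * Real.exp (-A * N.1 * h N.1 N.2 ^ (2 * k * p))) L (𝓝 0))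
    {c : ℝ} (hc : 0 < c) :
    Tendsto (fun N : ℕ × ℕ => (N.2 : ENNReal) ^ k * (2 * ENNReal.ofReal (Real.exp
      (-(c * (N.1 / k : ℕ) * h N.1 N.2 ^ (2 * k * p)))))) L (𝓝 0) := by
  have hkR : (0 : ℝ) < k := by exact_mod_cast hk
  -- The `k`-th power turns `n'` into `n'^k` and the rate `c / (2 k²)` into `c / (2 k)`; for `n ≥ k`
  -- one has `n ≤ 2 k ⌊n/k⌋`, so the resulting exponent is at most `c ⌊n/k⌋ h^{2kp}`.
  have h1 := ((hrate (c / (2 * k ^ 2)) (by positivity)).pow k).const_mul 2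
  rw [zero_pow hk.ne', mul_zero] at h1
  have h2 := ENNReal.tendsto_ofReal h1
  rw [ENNReal.ofReal_zero] at h2
  have hn : ∀ᶠ N : ℕ × ℕ in L, k ≤ N.1 :=
    hL (tendsto_fst.eventually (eventually_ge_atTop k))
  refine tendsto_of_tendsto_of_tendsto_of_le_of_le' tendsto_const_nhds h2
    (Eventually.of_forall fun _ => zero_le) ?_
  filter_upwards [hn] with N hN
  have hH := pow_pos (hh N.1 N.2) (2 * k * p)
  have hdiv : (N.1 : ℝ) ≤ 2 * k * (N.1 / k : ℕ) := by
    have hm : 1 ≤ N.1 / k := (Nat.one_le_div_iff hk).2 hN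
    have := Nat.lt_mul_div_succ N.1 hk
    have h3 : N.1 ≤ 2 * k * (N.1 / k) := by nlinarith
    exact_mod_cast h3
  have hle : Real.exp (-(c * (N.1 / k : ℕ) * h N.1 N.2 ^ (2 * k * p))) ≤
      Real.exp (-(c / (2 * k ^ 2)) * N.1 * h N.1 N.2 ^ (2 * k * p)) ^ k := by
    rw [← Real.exp_nat_mul]
    refine Real.exp_le_exp.2 ?_
    have h4 := mul_le_mul_of_nonneg_left hdiv
      (show 0 ≤ c / (2 * k) * h N.1 N.2 ^ (2 * k * p) by positivity)
    have h5 : c / (2 * k) * h N.1 N.2 ^ (2 * k * p) * (2 * k * (N.1 / k : ℕ)) =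
        c * (N.1 / k : ℕ) * h N.1 N.2 ^ (2 * k * p) := by field_simp
    have h6 : (k : ℝ) * (-(c / (2 * k ^ 2)) * N.1 * h N.1 N.2 ^ (2 * k * p)) =
        -(c / (2 * k) * h N.1 N.2 ^ (2 * k * p) * N.1) := by field_simp
    rw [h6]
    linarith
  rw [mul_pow, ENNReal.ofReal_mul (by norm_num), ENNReal.ofReal_mul (by positivity),
    ENNReal.ofReal_pow (by positivity), ENNReal.ofReal_natCast, ENNReal.ofReal_ofNat]
  calc _ = 2 * ((N.2 : ENNReal) ^ k * ENNReal.ofReal (Real.exp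
      (-(c * (N.1 / k : ℕ) * h N.1 N.2 ^ (2 * k * p))))) := by ring
    _ ≤ _ := by gcongr

theorem measure_exists_le {Ω ι : Type*} [MeasurableSpace Ω] {P : Measure Ω} (I : Finset ι)
    {s : ι → Set Ω} {b : ENNReal} (hb : ∀ i ∈ I, P (s i) ≤ b) :
    P {ω | ∃ i ∈ I, ω ∈ s i} ≤ I.card * b := by
  have : {ω | ∃ i ∈ I, ω ∈ s i} = ⋃ i ∈ I, s i := by ext; simp
  rw [this]
  refine (measure_biUnion_finset_le I s).trans ((Finset.sum_le_card_nsmul I _ _ hb).trans_eq ?_)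
  rw [nsmul_eq_mul]

section Estimator

variable {Ω : Type*} [MeasurableSpace Ω] {P : Measure Ω} [IsProbabilityMeasure P]
  {𝒳 : Type*} [MeasurableSpace 𝒳] {μ : Measure 𝒳} [SigmaFinite μ] {p k : ℕ}
  {X : ℕ → Ω → 𝒳} {Z : ℕ → Ω → Fin p → ℝ} {f : 𝒳 → (Fin p → ℝ) → ℝ}
  {𝒵 : Set (Fin p → ℝ)} {K : (Fin p → ℝ) → ℝ} {L : Filter (ℕ × ℕ)} {h : ℕ → ℕ → ℝ}

/-- The kernel U-statistics at all the design points are simultaneously close to their limits,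
with probability tending to one. -/
theorem tendsto_measure_exists_deviation (hk : 0 < k) (hX : ∀ i, Measurable (X i))
    (hZ : ∀ i, Measurable (Z i)) (hindep : iIndepFun (fun i ω => (X i ω, Z i ω)) P)
    (hlaw : ∀ i, P.map (fun ω => (X i ω, Z i ω)) = pairLaw μ f)
    (hf : Measurable (Function.uncurry f)) (hf0 : ∀ x z, 0 ≤ f x z)
    {g : (Fin k → 𝒳) → ℝ} (hg : Measurable g) {B : ℝ} (hB0 : 0 ≤ B) (hB : MomentBound μ f g B)
    {fmax : ℝ} (hmax : ∀ z, fZ μ f z ≤ fmax) (h𝒵 : IsCompact 𝒵)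
    (hcont : ∀ z ∈ 𝒵, ContinuousAt (fZ μ f) z) (hpos : ∀ z ∈ 𝒵, 0 < fZ μ f z)
    (hfx : ∀ z ∈ 𝒵, ∀ᵐ x ∂μ, ContinuousAt (f x) z) {α : ℕ} (hK : KernelAssumption K α)
    (z' : (n' : ℕ) → Fin n' → Fin p → ℝ) (hz' : ∀ n' i, z' n' i ∈ 𝒵)
    (I : (n' : ℕ) → Finset (Fin k ↪ Fin n')) (hL : L ≤ atTop ×ˢ atTop)
    (hh : ∀ n n', 0 < h n n') (hh0 : Tendsto (fun N : ℕ × ℕ => h N.1 N.2) L (𝓝 0))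
    (hrate : ∀ A : ℝ, 0 < A → Tendsto
      (fun N : ℕ × ℕ => (N.2 : ℝ) * Real.exp (-A * N.1 * h N.1 N.2 ^ (2 * k * p))) L (𝓝 0))
    {t : ℝ} (ht : 0 < t) :
    Tendsto (fun N : ℕ × ℕ => P {ω | ∃ τ ∈ I N.2, ω ∈ {ω | t ≤
      |(embAvg fun σ : Fin k ↪ Fin N.1 => kernelTerm K (h N.1 N.2) g (fun i => z' N.2 (τ i))
        fun i => (X (σ i) ω, Z (σ i) ω)) - numer μ f g fun i => z' N.2 (τ i)|}}) L (𝓝 0) := by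
  obtain ⟨hKm, ⟨a, ha⟩, hKint, hK1, -⟩ := hK
  obtain ⟨c, hc, h₀, hh₀, hdev⟩ := exists_kernel_deviation_bound hX hZ hindep hlaw hf hf0 hg hB0
    hB hmax h𝒵 hcont hpos hfx hKm ha hKint hK1 ht
  refine tendsto_of_tendsto_of_tendsto_of_le_of_le' tendsto_const_nhds
    (tendsto_union_bound hk hL hh hrate hc) (Eventually.of_forall fun _ => zero_le) ?_
  filter_upwards [hh0.eventually_lt_const hh₀] with N hN
  refine (measure_exists_le (I N.2) fun τ _ => hdev (h N.1 N.2) (hh _ _) hN (N.1 / k) N.1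
    (Nat.div_mul_le_self _ _) (fun i => z' N.2 (τ i)) fun i => hz' _ _).trans ?_
  refine mul_le_mul_left ?_ _
  have hcard : (I N.2).card ≤ N.2 ^ k := by
    refine (Finset.card_le_univ _).trans ?_
    rw [Fintype.card_embedding_eq, Fintype.card_fin, Fintype.card_fin]
    exact Nat.descFactorial_le_pow _ _
  exact_mod_cast hcard

end Estimator

end CondUStat

/-! ### Assembly: convergence in probability of the minimizers. -/

theorem mainTheorem9
    {Ω : Type*} [MeasurableSpace Ω] (P : Measure Ω) [IsProbabilityMeasure P]
    {𝒳 : Type*} [MeasurableSpace 𝒳] (μ : Measure 𝒳) [SigmaFinite μ]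
    {p k r : ℕ} (hk : 0 < k) (α : ℕ) (hα : 0 < α)
    -- the i.i.d. sample, with joint density `f` with respect to `μ ⊗ Leb`
    (X : ℕ → Ω → 𝒳) (Z : ℕ → Ω → Fin p → ℝ)
    (hX : ∀ i, Measurable (X i)) (hZ : ∀ i, Measurable (Z i))
    (hindep : iIndepFun (fun i ω => (X i ω, Z i ω)) P)
    (f : 𝒳 → (Fin p → ℝ) → ℝ) (hf : Measurable (Function.uncurry f)) (hf0 : ∀ x z, 0 ≤ f x z)
    (hlaw : ∀ i, P.map (fun ω => (X i ω, Z i ω)) =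
      (μ.prod volume).withDensity (fun q => ENNReal.ofReal (f q.1 q.2)))
    (g : (Fin k → 𝒳) → ℝ) (hg : Measurable g)
    -- the assumptions on the kernel, on the densities and on the conditional moments
    (𝒵 : Set (Fin p → ℝ)) (h𝒵 : IsCompact 𝒵)
    (K : (Fin p → ℝ) → ℝ) (hK : CondUStat.KernelAssumption K α)
    (hfZ : CondUStat.DensitySmoothness k K α 𝒵 (CondUStat.fZ μ f))
    (hfmax : ∃ fmax : ℝ, ∀ z, CondUStat.fZ μ f z ≤ fmax)
    (hfmin : ∃ fmin : ℝ, 0 < fmin ∧ ∀ z ∈ 𝒵, fmin < CondUStat.fZ μ f z)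
    (hholder : CondUStat.JointHolder μ f g K α 𝒵)
    (hbern : CondUStat.CondBernstein μ f g (P.map (Z 0)))
    -- the parametric model
    (ψ : (Fin k → Fin p → ℝ) → Fin r → ℝ) (Λ : ℝ → ℝ) (βstar : Fin r → ℝ)
    (hlink : CondUStat.LinkAssumption μ f g 𝒵 ψ Λ)
    (hmodel : ∀ z : Fin k → Fin p → ℝ, (∀ i, z i ∈ 𝒵) →
      Λ (CondUStat.theta μ f g z) = ψ z ⬝ᵥ βstar)
    -- the design points, the collections of injections, and the limit Gram matrix
    (z' : (n' : ℕ) → Fin n' → Fin p → ℝ) (hz' : ∀ n' i, z' n' i ∈ 𝒵)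
    (I : (n' : ℕ) → Finset (Fin k ↪ Fin n'))
    (M : Matrix (Fin r) (Fin r) ℝ)
    (hM : Tendsto (fun n' => CondUStat.gramMatrix ψ (z' n') (I n')) atTop (𝓝 M))
    -- the regime `(n, n') → ∞`, the bandwidth and the tuning parameter
    (L : Filter (ℕ × ℕ)) [L.NeBot] (hL : L ≤ atTop ×ˢ atTop)
    (h : ℕ → ℕ → ℝ) (hh : ∀ n n', 0 < h n n')
    (hh0 : Tendsto (fun N : ℕ × ℕ => h N.1 N.2) L (𝓝 0))
    (hrate : ∀ A : ℝ, 0 < A → Tendsto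
      (fun N : ℕ × ℕ => (N.2 : ℝ) * Real.exp (-A * N.1 * h N.1 N.2 ^ (2 * k * p))) L (𝓝 0))
    (lam : ℕ → ℕ → ℝ) (hlam : ∀ n n', 0 ≤ lam n n') (lam0 : ℝ)
    (hlam0 : Tendsto (fun N : ℕ × ℕ => lam N.1 N.2) L (𝓝 lam0))
    -- the estimator: any minimizer of the criterion, on the event where the criterion is defined
    (βhat : ℕ → ℕ → Ω → Fin r → ℝ)
    (hβ : ∀ n n' ω,
      (∀ σ ∈ I n', 0 < CondUStat.thetaHatDenom K (h n n') (fun i : Fin n => Z i ω)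
        (fun i => z' n' (σ i))) →
      βhat n n' ω ∈ CondUStat.argminSet (CondUStat.lassoCriterion ψ (z' n') (I n')
        (fun σ => Λ (CondUStat.thetaHat K (h n n') g (fun i : Fin n => X i ω)
          (fun i : Fin n => Z i ω) (fun i => z' n' (σ i)))) (lam n n'))) :
    -- the limit criterion has a minimizer
    (CondUStat.argminSet (CondUStat.limitCriterion M βstar lam0)).Nonempty ∧
    -- convergence in probability to the set of minimizers
    (0 < lam0 ∨ IsUnit M.det → ∀ ε : ℝ, 0 < ε → Tendsto (fun N : ℕ × ℕ =>
      P {ω | ε ≤ Metric.infDist (βhat N.1 N.2 ω)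
        (CondUStat.argminSet (CondUStat.limitCriterion M βstar lam0))}) L (𝓝 0)) ∧
    -- convergence in probability to the minimizer, when it is unique
    (∀ b, CondUStat.argminSet (CondUStat.limitCriterion M βstar lam0) = {b} →
      TendstoInMeasure P (fun (N : ℕ × ℕ) ω => βhat N.1 N.2 ω) L (fun _ => b)) ∧
    -- consistency
    (lam0 = 0 → IsUnit M.det →
      TendstoInMeasure P (fun (N : ℕ × ℕ) ω => βhat N.1 N.2 ω) L (fun _ => βstar)) := by
  have hpl : ∀ i, P.map (fun ω => (X i ω, Z i ω)) = CondUStat.pairLaw μ f := hlaw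
  have hprob : IsProbabilityMeasure (CondUStat.pairLaw μ f) := by
    rw [← hpl 0]; exact Measure.isProbabilityMeasure_map ((hX 0).prodMk (hZ 0)).aemeasurable
  obtain ⟨fmax, hfmax⟩ := hfmax
  obtain ⟨fmin, hfmin0, hfmin⟩ := hfmin
  have hpos : ∀ z ∈ 𝒵, 0 < CondUStat.fZ μ f z := fun z hz => hfmin0.trans (hfmin z hz)
  have hcont := hfZ.continuousAt hK.2.2.2.1
  have hfx : ∀ z ∈ 𝒵, ∀ᵐ x ∂μ, ContinuousAt (f x) z := fun z hz =>
    (hholder.2.1 z hz).mono fun x hx => hx.continuousAt hα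
  have hνeq : P.map (Z 0) = (CondUStat.pairLaw μ f).map Prod.snd := by
    rw [← hpl 0, Measure.map_map measurable_snd ((hX 0).prodMk (hZ 0))]
    rfl
  obtain ⟨B, hB0, hB⟩ := hbern.exists_momentBound hf hf0 hνeq
  have hB1 := CondUStat.momentBound_one (k := k) (μ := μ) hf hf0
  set S : Set (Fin k → Fin p → ℝ) := Set.univ.pi fun _ => 𝒵 with hSdef
  have hS : IsCompact S := isCompact_univ_pi fun _ => h𝒵
  obtain ⟨⟨Cψ, hCψ⟩, V, hV, hθV, hΛ, -⟩ := hlink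
  -- Empirical Gram matrices are positive semidefinite and symmetric; both properties pass to the
  -- limit.
  have hquad : ∀ v : Fin r → ℝ, 0 ≤ v ⬝ᵥ M.mulVec v := fun v => by
    have hc : Continuous fun A : Matrix (Fin r) (Fin r) ℝ => v ⬝ᵥ A.mulVec v := by fun_prop
    refine ge_of_tendsto' ((hc.tendsto M).comp hM) fun n' => ?_
    simp only [Function.comp_apply, CondUStat.gramMatrix_quadratic]
    positivity
  have hsymm : M.transpose = M := by
    have hc : Continuous fun A : Matrix (Fin r) (Fin r) ℝ => A.transpose := by fun_prop
    refine tendsto_nhds_unique ((hc.tendsto M).comp hM) ?_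
    simpa only [Function.comp_def, CondUStat.gramMatrix_transpose] using hM
  have hlam0' : 0 ≤ lam0 := ge_of_tendsto' hlam0 fun N => hlam _ _
  set G := CondUStat.limitCriterion M βstar lam0 with hG
  have hGc : Continuous G := CondUStat.continuous_limitCriterion_right
  -- The common core of the conclusions: only a nonempty compact set of minimizers is needed.
  have hconv : IsCompact (CondUStat.argminSet G) → (CondUStat.argminSet G).Nonempty →
      ∀ ε : ℝ, 0 < ε → Tendsto (fun N : ℕ × ℕ =>
        P {ω | ε ≤ Metric.infDist (βhat N.1 N.2 ω) (CondUStat.argminSet G)}) L (𝓝 0) := by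
    intro hcomp hne ε hε
    obtain ⟨δ, hδ, R, hstab⟩ := CondUStat.exists_stability_argminSet hGc hcomp hne hε
    set D := 2 * (r * |Cψ| * (‖βstar‖ + |R|)) with hD
    have hD0 : 0 ≤ D := by positivity
    -- The tolerance `δ` is split in two: one half for errors in the responses, where `D` bounds `2
    -- r Cψ ‖β* - β‖` on the ball of radius `R`, and one half for the convergence of the Gram matrix
    -- and of `lam`.
    obtain ⟨η, hη, hηδ⟩ : ∃ η : ℝ, 0 < η ∧ η ^ 2 + η * D ≤ δ / 2 := by
      refine ⟨min 1 (δ / (2 * (1 + D))), by positivity, ?_⟩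
      set η := min 1 (δ / (2 * (1 + D)))
      have h0 : 0 < η := by positivity
      have h1 : η ≤ 1 := min_le_left _ _
      have h2 : η * (2 * (1 + D)) ≤ δ := (le_div_iff₀ (by positivity)).1 (min_le_right _ _)
      nlinarith
    have hN1 := CondUStat.continuousOn_numer hf hf0 hg hB hfmax hcont hpos hfx
    have hN2 := CondUStat.continuousOn_numer (k := k) hf hf0 measurable_const hB1 hfmax hcont
      hpos hfx
    obtain ⟨t, ht, hlinkδ⟩ := CondUStat.exists_delta_link (Λ := Λ) hS
      (fun z hz => (hN1.2 z hz).mono hN1.1) (fun z hz => (hN2.2 z hz).mono hN2.1)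
      (fun z hz => by
        rw [CondUStat.numer_one]
        exact Finset.prod_pos fun i _ => hpos _ (hz i trivial))
      (fun z hz => by
        rw [← CondUStat.theta_eq_div]
        exact hΛ.continuousOn.continuousAt (hV.mem_nhds (hθV z fun i => hz i trivial))) hη
    have hbad1 := CondUStat.tendsto_measure_exists_deviation hk hX hZ hindep hpl hf hf0 hg hB0 hB
      hfmax h𝒵 hcont hpos hfx hK z' hz' I hL hh hh0 hrate ht
    have hbad2 := CondUStat.tendsto_measure_exists_deviation hk hX hZ hindep hpl hf hf0
      measurable_const zero_le_one hB1 hfmax h𝒵 hcont hpos hfx hK z' hz' I hL hh hh0 hrate ht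
    have hbad := hbad1.add hbad2
    rw [add_zero] at hbad
    have hgram : Tendsto (fun N : ℕ × ℕ => (CondUStat.gramMatrix ψ (z' N.2) (I N.2), lam N.1 N.2))
        L (𝓝 (M, lam0)) :=
      (hM.comp (tendsto_snd.mono_left hL)).prodMk_nhds hlam0
    refine tendsto_of_tendsto_of_tendsto_of_le_of_le' tendsto_const_nhds hbad
      (Eventually.of_forall fun _ => zero_le) ?_
    filter_upwards [hgram.eventually
      (CondUStat.eventually_limitCriterion_near M βstar lam0 R (half_pos hδ))] with N hN
    -- Only an inclusion of events is used, so `βhat` need not be measurable: outside the two bad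
    -- events every denominator is positive and `βhat` minimizes the criterion.
    refine (measure_mono fun ω hω => ?_).trans (measure_union_le _ _)
    by_contra hgood
    simp only [Set.mem_union, Set.mem_ofPred_eq, not_or, not_exists, not_and, not_le] at hgood
    have hσ : ∀ σ ∈ I N.2, 0 < CondUStat.thetaHatDenom K (h N.1 N.2) (fun i : Fin N.1 => Z i ω)
        (fun i => z' N.2 (σ i)) ∧ |Λ (CondUStat.thetaHat K (h N.1 N.2) g
          (fun i : Fin N.1 => X i ω) (fun i : Fin N.1 => Z i ω) (fun i => z' N.2 (σ i))) -
          ψ (fun i => z' N.2 (σ i)) ⬝ᵥ βstar| ≤ η := by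
      intro σ hσ
      have hmem : (fun i => z' N.2 (σ i)) ∈ S := fun i _ => hz' _ _
      obtain ⟨h1, h2⟩ := hlinkδ _ hmem _ _ (hgood.1 σ hσ) (hgood.2 σ hσ)
      obtain ⟨h3, h4⟩ := CondUStat.thetaHatDenom_pos_of_embAvg
        (Xs := fun i : Fin N.1 => X i ω) (Zs := fun i : Fin N.1 => Z i ω) g h1
      refine ⟨h3, ?_⟩
      rw [h4, ← hmodel _ fun i => hz' _ _, CondUStat.theta_eq_div]
      exact h2.le
    have hmin := hβ N.1 N.2 ω fun σ hσI => (hσ σ hσI).1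
    refine absurd (hstab _ (CondUStat.convexOn_lassoCriterion ψ (z' N.2) (I N.2) _ (hlam _ _))
      (fun β hβR => ?_) _ hmin) (not_lt.2 hω)
    have h1 := CondUStat.abs_lassoCriterion_sub_le (z' := z' N.2) (I := I N.2)
      (y := fun σ => Λ (CondUStat.thetaHat K (h N.1 N.2) g
          (fun i : Fin N.1 => X i ω) (fun i : Fin N.1 => Z i ω) (fun i => z' N.2 (σ i))))
      (lam N.1 N.2) hη.le (abs_nonneg Cψ)
      (fun σ _ => (hCψ _ fun i => hz' _ _).trans (le_abs_self _)) (fun σ hσI => (hσ σ hσI).2) β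
    have h2 := hN β hβR
    have h3 : ‖βstar - β‖ ≤ ‖βstar‖ + |R| :=
      (norm_sub_le _ _).trans (by gcongr; exact hβR.trans (le_abs_self _))
    have h4 : 2 * η * (r * |Cψ| * ‖βstar - β‖) ≤ η * D := by
      have := mul_le_mul_of_nonneg_left h3 (show 0 ≤ 2 * η * (r * |Cψ|) by positivity)
      rw [hD]
      linarith
    refine (abs_sub_le _ (CondUStat.limitCriterion (CondUStat.gramMatrix ψ (z' N.2) (I N.2)) βstar
      (lam N.1 N.2) β) _).trans ?_
    linarith
  have hunique : ∀ b, CondUStat.argminSet G = {b} →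
      TendstoInMeasure P (fun (N : ℕ × ℕ) ω => βhat N.1 N.2 ω) L (fun _ => b) := by
    intro b hb
    rw [tendstoInMeasure_iff_dist]
    intro ε hε
    have := hconv (by rw [hb]; exact isCompact_singleton)
      (by rw [hb]; exact Set.singleton_nonempty b) ε hε
    simpa only [hb, Metric.infDist_singleton] using this
  refine ⟨?_, ?_, hunique, ?_⟩
  · rcases hlam0'.eq_or_lt with h0 | h0
    · rw [hG, ← h0]
      exact ⟨βstar, CondUStat.mem_argminSet_limitCriterion_zero hquad⟩
    · exact (CondUStat.argminSet_limitCriterion_of_pos hquad h0).2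
  · intro hor
    rcases hlam0'.eq_or_lt with h0 | h0
    · have hset : CondUStat.argminSet G = {βstar} := by
        rw [hG, ← h0]
        exact CondUStat.argminSet_limitCriterion_zero hquad hsymm
          (hor.resolve_left (by rw [← h0]; exact lt_irrefl _))
      exact hconv (by rw [hset]; exact isCompact_singleton)
        (by rw [hset]; exact Set.singleton_nonempty βstar)
    · obtain ⟨h1, h2⟩ := CondUStat.argminSet_limitCriterion_of_pos (βstar := βstar) hquad h0
      exact hconv h1 h2
  · intro h0 hdet
    refine hunique βstar ?_
    rw [hG, h0]
    exact CondUStat.argminSet_limitCriterion_zero hquad hsymm hdet
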